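/- Let $X=(X_1,\dots,X_n)$ be a Gaussian vector in $\mathbb{R}^n$ (not necessarily centred or non-degenerate) with covariance kernel $K(i,j)=\mathrm{Cov}[X_i,X_j]$. A Borel set $A\subseteq\mathbb{R}^n$ is called an increasing event if $\{X\in A\}\subseteq\{X+v\in A\}$ for every $v\in\mathbb{R}^n$ with $v\ge 0$ coordinatewise, and it is said to be supported on $I\subseteq\{1,\dots,n\}$, written $A\in\sigma(I)$, if $\{X\in A\}=\{X+v\in A\}$ for every $v\in\mathbb{R}^n$ with $v|_I=0$. The capacity of $I$ is \[ \mathrm{Cap}(I)=\Big(\inf_{\mu\in\mathcal{P}(I)}\sum_{i,j\in I}\mu(i)K(i,j)\mu(j)\Big)^{-1}\in[0,\infty], \] where $\mathcal{P}(I)$ is the set of probability measures on $I$ (so $\mathrm{Cap}(I)=\infty$ if the infimum is $0$, and $\mathrm{Cap}(\emptyset)=0$), and $\|K_{I_1,I_2}\|_\infty=\max_{i\in I_1,\,j\in I_2}|K(i,j)|$ (equal to $0$ if $I_1$ or $I_2$ is empty). There exists a universal constant $c>0$ such that for all $n$, all Gaussian vectors $X$ in $\mathbb{R}^n$, all $I_1,I_2\subseteq\{1,\dots,n\}$,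 and all increasing events $A_1\in\sigma(I_1)$ and $A_2\in\sigma(I_2)$, \[ \big|\mathbb{P}[X\in A_1\cap A_2]-\mathbb{P}[X\in A_1]\,\mathbb{P}[X\in A_2]\big|\le c\Big(\sqrt{\mathrm{Cap}(I_1)\,\mathrm{Cap}(I_2)}\;\|K_{I_1,I_2}\|_\infty\Big)^{1/3}, \] where the right-hand side is computed in $[0,\infty]$ with the convention $0\cdot\infty=0$. -/

import Mathlib

open MeasureTheory ProbabilityTheory
open scoped NNReal ENNReal

namespace GaussianDecoupling

/-- The covariance kernel `K(i, j) = Cov[X_i, X_j]` of a random vector `X`. -/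
noncomputable def covKernel {Ω : Type*} [MeasurableSpace Ω] {n : ℕ}
    (P : Measure Ω) (X : Ω → (Fin n → ℝ)) (i j : Fin n) : ℝ :=
  cov[fun ω => X ω i, fun ω => X ω j; P]

/-- `A ⊆ ℝⁿ` is an increasing event for `X`: for every `v ≥ 0` (coordinatewise),
`{X ∈ A} ⊆ {X + v ∈ A}`. In particular this holds if `A` is an upper set. -/
def IsIncreasing {Ω : Type*} {n : ℕ} (X : Ω → (Fin n → ℝ)) (A : Set (Fin n → ℝ)) : Prop :=
  ∀ v : Fin n → ℝ, 0 ≤ v → {ω | X ω ∈ A} ⊆ {ω | X ω + v ∈ A}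

/-- `A ⊆ ℝⁿ` is supported on the coordinates `I`, written `A ∈ σ(I)`: for every `v` that vanishes
on `I`, `{X ∈ A} = {X + v ∈ A}`. -/
def IsSupportedOn {Ω : Type*} {n : ℕ} (X : Ω → (Fin n → ℝ)) (I : Finset (Fin n))
    (A : Set (Fin n → ℝ)) : Prop :=
  ∀ v : Fin n → ℝ, (∀ i ∈ I, v i = 0) → {ω | X ω ∈ A} = {ω | X ω + v ∈ A}

/-- The capacity of `I` for a covariance kernel `K`, as an element of `[0, ∞]`: the inverse of the
infimum of `∑ i j ∈ I, μ i * K i j * μ j` over the probability vectors `μ` on `I`. A covariance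
kernel is positive semidefinite, so `ENNReal.ofReal` truncates nothing. The capacity is `∞` when
the infimum is `0`, and it is `0` when `I` is empty (the infimum being then `∞`). -/
noncomputable def capacity {n : ℕ} (K : Fin n → Fin n → ℝ) (I : Finset (Fin n)) : ℝ≥0∞ :=
  (⨅ μ ∈ stdSimplex ℝ I, ENNReal.ofReal (∑ i : I, ∑ j : I, μ i * K i j * μ j))⁻¹

/-- The maximum `‖K_{I,J}‖_∞` of `|K i j|` over `i ∈ I`, `j ∈ J` (and `0` if `I` or `J` is
empty). -/
noncomputable def supNormBlock {n : ℕ} (K : Fin n → Fin n → ℝ) (I J : Finset (Fin n)) : ℝ≥0 :=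
  (I ×ˢ J).sup fun p => ‖K p.1 p.2‖₊

end GaussianDecoupling

/-! Write κ for the largest |K(i,j)| between the blocks, and q, r for the minimal energies of the
blocks, so that the capacities are 1/q and 1/r. Each indicator is replaced by a function that is
monotone in its block and grows at rate 1/ε (resp. 1/δ) along the diagonal. Two estimates are then
balanced.

Decoupling (`ShiftLipschitz.abs_covariance_le`): two such functions have covariance at most κ/(εδ).
The Gaussian law is a convolution of N independent small copies. Each copy contributes κ/(εδN) to
first order, because the gradients are nonnegative with mass at most 1/ε and 1/δ, and the Taylor
errors vanish as N grows.

Approximation (`ShiftLipschitz.integral_sub_shift_le`): the L¹ error is at most the effect of a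
diagonal shift by ε. Let T be the average of X against the equilibrium vector, of variance q. The
regression of X on T has coefficients at least 1 on the block, so the diagonal shift costs no more
than shifting the one-dimensional Gaussian T by ε, namely ε/√q.

The sum κ/(εδ) + 2(ε/√q + δ/√r) is made of equal scales by ε = t√q, δ = t√r, t³ = κ/√(qr), which
produces the exponent 1/3. -/

namespace GaussianDecoupling

/-! ### Lipschitz majorants of increasing events -/

/-- `F` is monotone in the coordinates `I`, depends on these coordinates only, and grows at most at
rate `L` along the diagonal. -/
def ShiftLipschitz {n : ℕ} (I : Finset (Fin n)) (L : ℝ) (F : (Fin n → ℝ) → ℝ) : Prop :=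
  ∀ ⦃x y : Fin n → ℝ⦄ ⦃s : ℝ⦄, 0 ≤ s → (∀ i ∈ I, x i ≤ y i + s) → F x ≤ F y + L * s

lemma ShiftLipschitz.lipschitzWith {n : ℕ} {I : Finset (Fin n)} {L : ℝ} {F : (Fin n → ℝ) → ℝ}
    (hF : ShiftLipschitz I L F) : LipschitzWith L.toNNReal F := by
  refine LipschitzWith.of_le_add_mul _ fun x y => ?_
  refine (hF (y := y) (dist_nonneg (x := x) (y := y)) fun i _ => ?_).trans ?_
  · have := (Real.dist_eq (x i) (y i)) ▸ dist_le_pi_dist x y i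
    linarith [le_abs_self (x i - y i)]
  · gcongr
    exact Real.le_coe_toNNReal L

/-- An increasing event supported on `I` has a Lipschitz majorant which drops to the indicator
after a shift by `ε` along the diagonal. -/
lemma exists_shiftLipschitz_majorant {Ω : Type*} {n : ℕ} {X : Ω → (Fin n → ℝ)}
    {I : Finset (Fin n)} {A : Set (Fin n → ℝ)}
    (hinc : IsIncreasing X A) (hsup : IsSupportedOn X I A) {ε : ℝ} (hε : 0 < ε)
    (hne : ∃ ω, X ω ∈ A) :
    ∃ F : (Fin n → ℝ) → ℝ, ShiftLipschitz I ε⁻¹ F ∧ (∀ x, 0 ≤ F x) ∧ (∀ x, F x ≤ 1) ∧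
      (∀ ω, X ω ∈ A → F (X ω) = 1) ∧ ∀ ω, X ω ∉ A → F (X ω - fun _ => ε) = 0 := by
  -- `sInf (T x)` is how far `x` must climb the diagonal to dominate on `I` some point of `A`. Only
  -- values of `X` compete, since the hypotheses constrain `A` through these alone.
  set T : (Fin n → ℝ) → Set ℝ := fun x =>
    {s | 0 ≤ s ∧ ∃ ω, X ω ∈ A ∧ ∀ i ∈ I, X ω i ≤ x i + s} with hT
  have hbdd : ∀ x, BddBelow (T x) := fun x => ⟨0, fun s hs => hs.1⟩
  have hTne : ∀ x, (T x).Nonempty := by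
    intro x
    obtain ⟨ω, hω⟩ := hne
    refine ⟨‖X ω - x‖, norm_nonneg _, ω, hω, fun i _ => ?_⟩
    have h1 := norm_le_pi_norm (X ω - x) i
    have h2 := le_abs_self (X ω i - x i)
    simp only [Pi.sub_apply, Real.norm_eq_abs] at h1
    linarith
  have hD0 : ∀ x, 0 ≤ sInf (T x) := fun x => le_csInf (hTne x) fun s hs => hs.1
  have hDs : ∀ ⦃x y : Fin n → ℝ⦄ ⦃s : ℝ⦄, 0 ≤ s → (∀ i ∈ I, x i ≤ y i + s) →
      sInf (T y) ≤ sInf (T x) + s := by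
    intro x y s hs hxy
    rw [← sub_le_iff_le_add]
    refine le_csInf (hTne x) fun r ⟨hr, ω, hω, hle⟩ => ?_
    rw [sub_le_iff_le_add]
    exact csInf_le (hbdd y) ⟨by positivity, ω, hω, fun i hi => by linarith [hle i hi, hxy i hi]⟩
  refine ⟨fun x => max 0 (1 - ε⁻¹ * sInf (T x)), ?_, fun x => le_max_left _ _, fun x => ?_,
    fun ω hω => ?_, fun ω hω => ?_⟩
  · intro x y s hs hxy
    have h := mul_le_mul_of_nonneg_left (hDs hs hxy) (inv_nonneg.2 hε.le)
    have h' : 0 ≤ ε⁻¹ * s := by positivity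
    refine max_le (by positivity) ?_
    linarith [le_max_right 0 (1 - ε⁻¹ * sInf (T y))]
  · have : 0 ≤ ε⁻¹ * sInf (T x) := mul_nonneg (inv_nonneg.2 hε.le) (hD0 x)
    exact max_le zero_le_one (by linarith)
  · have : sInf (T (X ω)) = 0 :=
      le_antisymm (csInf_le (hbdd _) ⟨le_rfl, ω, hω, by simp⟩) (hD0 _)
    simp [this]
  · refine max_eq_left ?_
    suffices ε ≤ sInf (T (X ω - fun _ => ε)) by
      have := mul_le_mul_of_nonneg_left this (inv_nonneg.2 hε.le)
      rw [inv_mul_cancel₀ hε.ne'] at this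
      linarith
    refine le_csInf (hTne _) fun s ⟨hs, ω', hω', hle⟩ => ?_
    by_contra! hlt
    refine hω ?_
    -- The coordinatewise maximum of `X ω` and `X ω'` is reached from `X ω'` by a nonnegative
    -- vector, and from `X ω` by a vector vanishing on `I`; both translations start at values of
    -- `X`.
    have hv : X ω' + (fun i => max (X ω i - X ω' i) 0) ∈ A :=
      hinc (fun i => max (X ω i - X ω' i) 0) (fun i => le_max_right _ _) hω'
    have := Set.ext_iff.1 (hsup (fun i => max (X ω' i - X ω i) 0) fun i hi => ?_) ω
    · refine this.2 ?_
      have e : (X ω + fun i => max (X ω' i - X ω i) 0) = X ω' + fun i => max (X ω i - X ω' i) 0 := by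
        ext i
        simp only [Pi.add_apply]
        rcases le_total (X ω i) (X ω' i) with h | h
        · rw [max_eq_left (by linarith), max_eq_right (by linarith)]; ring
        · rw [max_eq_right (by linarith), max_eq_left (by linarith)]; ring
      exact (congrArg (· ∈ A) e).mpr hv
    · have := hle i hi
      simp only [Pi.sub_apply] at this
      exact max_eq_right (by linarith)

/-! ### Equilibrium vectors -/

/-- A kernel has a probability vector on `I` attaining the infimum of the quadratic form, and its
potential is at least this infimum everywhere on `I`. -/
lemma exists_equilibrium {n : ℕ} {K : Fin n → Fin n → ℝ} (hK : ∀ i j, K i j = K j i)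
    {I : Finset (Fin n)} (hI : I.Nonempty) :
    ∃ μ ∈ stdSimplex ℝ I,
      capacity K I = (ENNReal.ofReal (∑ i : I, ∑ j : I, μ i * K i j * μ j))⁻¹ ∧
      ∀ i : I, ∑ a : I, ∑ b : I, μ a * K a b * μ b ≤ ∑ j : I, K i j * μ j := by
  classical
  set Q : (I → ℝ) → ℝ := fun μ => ∑ i : I, ∑ j : I, μ i * K i j * μ j with hQ
  have : Nonempty I := hI.to_subtype
  have hne : (stdSimplex ℝ I).Nonempty := ⟨_, single_mem_stdSimplex ℝ (Classical.arbitrary I)⟩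
  have hcont : Continuous Q := by fun_prop
  obtain ⟨μ, hμ, hmin⟩ := (isCompact_stdSimplex ℝ I).exists_isMinOn hne hcont.continuousOn
  refine ⟨μ, hμ, ?_, fun i => ?_⟩
  · unfold capacity
    congr 1
    refine le_antisymm (iInf₂_le μ hμ) (le_iInf₂ fun ν hν => ?_)
    exact ENNReal.ofReal_le_ofReal (hmin hν)
  · set p := ∑ j : I, K i j * μ j
    -- First variation at the minimiser towards the Dirac mass at `i`: this is the increment of `Q`
    -- divided by `t`. Letting `t → 0` gives `Q μ ≤ p`.
    have key : ∀ t : ℝ, 0 < t → t ≤ 1 → 0 ≤ 2 * (p - Q μ) + t * (K i i - 2 * p + Q μ) := by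
      intro t ht ht1
      have hmem : (1 - t) • μ + t • Pi.single i 1 ∈ stdSimplex ℝ I :=
        convex_stdSimplex ℝ I hμ (single_mem_stdSimplex ℝ i) (by linarith) ht.le (by ring)
      have h := hmin hmem
      have hexp : Q ((1 - t) • μ + t • Pi.single i 1)
          = (1 - t) ^ 2 * Q μ + 2 * t * (1 - t) * p + t ^ 2 * K i i := by
        simp only [hQ, p, Pi.add_apply, Pi.smul_apply, smul_eq_mul, add_mul, mul_add,
          Finset.sum_add_distrib, Pi.single_apply, mul_ite, ite_mul, mul_one, mul_zero, zero_mul,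
          Finset.sum_ite_eq', Finset.mem_univ, if_true, Finset.mul_sum]
        have h1 : ∀ a : I, K a i = K i a := fun a => hK _ _
        simp only [h1, Finset.sum_ite_irrel, Finset.sum_const_zero, Finset.sum_ite_eq',
          Finset.mem_univ, if_true]
        have e1 : ∑ x : I, (1 - t) * μ x * K i x * t = ∑ x : I, t * (1 - t) * (K i x * μ x) :=
          Finset.sum_congr rfl fun _ _ => by ring
        have e2 : ∑ x : I, t * K i x * ((1 - t) * μ x) = ∑ x : I, t * (1 - t) * (K i x * μ x) :=
          Finset.sum_congr rfl fun _ _ => by ring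
        have e3 : ∑ x : I, 2 * t * (1 - t) * (K i x * μ x)
            = 2 * ∑ x : I, t * (1 - t) * (K i x * μ x) := by
          rw [Finset.mul_sum]; exact Finset.sum_congr rfl fun _ _ => by ring
        have e4 : ∀ x y : I, (1 - t) * μ x * K x y * ((1 - t) * μ y)
            = (1 - t) ^ 2 * (μ x * K x y * μ y) := fun _ _ => by ring
        simp only [e1, e2, e3, e4]
        ring
      simp only [Set.mem_ofPred_eq] at h
      rw [hexp] at h
      have : 0 ≤ t * (2 * (p - Q μ) + t * (K i i - 2 * p + Q μ)) := by nlinarith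
      exact nonneg_of_mul_nonneg_right this ht
    have hlim : Filter.Tendsto (fun t : ℝ => 2 * (p - Q μ) + t * (K i i - 2 * p + Q μ))
        (nhdsWithin 0 (Set.Ioi 0)) (nhds (2 * (p - Q μ) + 0 * (K i i - 2 * p + Q μ))) :=
      ((by fun_prop : Continuous fun t : ℝ =>
        2 * (p - Q μ) + t * (K i i - 2 * p + Q μ)).tendsto 0).mono_left nhdsWithin_le_nhds
    have := ge_of_tendsto hlim (by
      filter_upwards [Ioc_mem_nhdsGT (zero_lt_one' ℝ)] with t ht using key t ht.1 ht.2)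
    show Q μ ≤ p
    linarith

/-! ### Monotone Taylor expansions and mollification -/

/-- `F` takes values in `[0, 1]` and has first order Taylor expansions with nonnegative gradient
`ℓ`, supported on `I` and of total mass at most `L`, and with remainder at most `M ‖v‖ ^ 2`. -/
structure HasMonotoneTaylor {n : ℕ} (I : Finset (Fin n)) (L M : ℝ) (F : (Fin n → ℝ) → ℝ)
    (ℓ : Fin n → (Fin n → ℝ) → ℝ) : Prop where
  measurable : Measurable F
  nonneg : ∀ x, 0 ≤ F x
  le_one : ∀ x, F x ≤ 1
  measurable_grad : ∀ i, Measurable (ℓ i)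
  grad_nonneg : ∀ i x, 0 ≤ ℓ i x
  grad_eq_zero : ∀ i x, i ∉ I → ℓ i x = 0
  sum_grad_le : ∀ x, ∑ i, ℓ i x ≤ L
  taylor : ∀ x v, |F (x + v) - F x - ∑ i, ℓ i x * v i| ≤ M * ‖v‖ ^ 2

lemma integrable_of_mem_Icc {α : Type*} [MeasurableSpace α] {μ : Measure α} [IsFiniteMeasure μ]
    {f : α → ℝ} (hf : AEStronglyMeasurable f μ) {b : ℝ} (h0 : ∀ x, 0 ≤ f x) (h1 : ∀ x, f x ≤ b) :
    Integrable f μ :=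
  Integrable.of_bound hf b (.of_forall fun x => by
    rw [Real.norm_of_nonneg (h0 x)]; exact h1 x)

namespace HasMonotoneTaylor

variable {n : ℕ} {I : Finset (Fin n)} {L M : ℝ} {F : (Fin n → ℝ) → ℝ}
  {ℓ : Fin n → (Fin n → ℝ) → ℝ}

lemma grad_le (h : HasMonotoneTaylor I L M F ℓ) (i : Fin n) (x : Fin n → ℝ) : ℓ i x ≤ L :=
  (Finset.single_le_sum (fun j _ => h.grad_nonneg j x) (Finset.mem_univ i)).trans (h.sum_grad_le x)

lemma abs_sum_le (h : HasMonotoneTaylor I L M F ℓ) (x v : Fin n → ℝ) :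
    |∑ i, ℓ i x * v i| ≤ L * ‖v‖ := by
  refine (Finset.abs_sum_le_sum_abs _ _).trans ?_
  calc ∑ i, |ℓ i x * v i| ≤ ∑ i, ℓ i x * ‖v‖ := Finset.sum_le_sum fun i _ => by
        rw [abs_mul, abs_of_nonneg (h.grad_nonneg i x)]
        exact mul_le_mul_of_nonneg_left (norm_le_pi_norm v i) (h.grad_nonneg i x)
    _ ≤ L * ‖v‖ := by
        rw [← Finset.sum_mul]
        exact mul_le_mul_of_nonneg_right (h.sum_grad_le x) (norm_nonneg v)

/-- The class is stable under averaging over translations. -/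
lemma average (h : HasMonotoneTaylor I L M F ℓ) (ρ : Measure (Fin n → ℝ))
    [IsProbabilityMeasure ρ] :
    HasMonotoneTaylor I L M (fun x => ∫ y, F (x + y) ∂ρ) (fun i x => ∫ y, ℓ i (x + y) ∂ρ) := by
  have hm : ∀ {f : (Fin n → ℝ) → ℝ}, Measurable f →
      Measurable fun x => ∫ y, f (x + y) ∂ρ := fun {f} hf =>
    (StronglyMeasurable.integral_prod_right (f := fun x y => f (x + y))
      (hf.comp measurable_add).stronglyMeasurable).measurable
  have hFi : ∀ x, Integrable (fun y => F (x + y)) ρ := fun x =>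
    integrable_of_mem_Icc (h.measurable.comp (measurable_const_add x)).aestronglyMeasurable
      (fun y => h.nonneg _) (fun y => h.le_one _)
  have hℓi : ∀ i x, Integrable (fun y => ℓ i (x + y)) ρ := fun i x =>
    integrable_of_mem_Icc
      ((h.measurable_grad i).comp (measurable_const_add x)).aestronglyMeasurable
      (fun y => h.grad_nonneg i _) (fun y => h.grad_le i _)
  refine ⟨hm h.measurable, fun x => integral_nonneg fun y => h.nonneg _, fun x => ?_,
    fun i => hm (h.measurable_grad i), fun i x => integral_nonneg fun y => h.grad_nonneg i _,
    fun i x hi => by simp [h.grad_eq_zero i _ hi], fun x => ?_, fun x v => ?_⟩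
  · simpa using integral_mono (hFi x) (integrable_const 1) fun y => h.le_one _
  · rw [← integral_finsetSum _ fun i _ => hℓi i x]
    simpa using integral_mono (integrable_finsetSum _ fun i _ => hℓi i x) (integrable_const L)
      fun y => by simpa using h.sum_grad_le (x + y)
  · have e : (∫ y, F (x + v + y) ∂ρ) - (∫ y, F (x + y) ∂ρ) - ∑ i, (∫ y, ℓ i (x + y) ∂ρ) * v i
        = ∫ y, (F (x + y + v) - F (x + y) - ∑ i, ℓ i (x + y) * v i) ∂ρ := by
      have h1 : ∀ y, x + y + v = x + v + y := fun y => by abel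
      simp only [h1]
      have h2 : Integrable (fun y => F (x + v + y) - F (x + y)) ρ := (hFi _).sub (hFi _)
      rw [integral_sub h2 (integrable_finsetSum _ fun i _ =>
        (hℓi i x).mul_const _), integral_sub (hFi _) (hFi _),
        integral_finsetSum _ fun i _ => (hℓi i x).mul_const _]
      simp only [integral_mul_const]
    rw [e]
    rw [← Real.norm_eq_abs]
    refine (norm_integral_le_of_norm_le_const (C := M * ‖v‖ ^ 2)
      (.of_forall fun y => ?_)).trans (by simp)
    exact h.taylor (x + y) v

end HasMonotoneTaylor

/-- Divide by `s` and let `s → 0`. This turns Taylor bounds into the sign, support and mass of the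
gradient. -/
lemma le_of_mul_le_mul_add_sq {a b M : ℝ} (h : ∀ s : ℝ, 0 < s → s * a ≤ s * b + M * s ^ 2) :
    a ≤ b := by
  have hlim : Filter.Tendsto (fun s : ℝ => b + M * s) (nhdsWithin 0 (Set.Ioi 0))
      (nhds (b + M * 0)) :=
    ((by fun_prop : Continuous fun s : ℝ => b + M * s).tendsto 0).mono_left nhdsWithin_le_nhds
  rw [mul_zero, add_zero] at hlim
  refine ge_of_tendsto hlim ?_
  filter_upwards [self_mem_nhdsWithin] with s hs
  refine le_of_mul_le_mul_left ?_ (Set.mem_Ioi.1 hs)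
  calc s * a ≤ s * b + M * s ^ 2 := h s hs
    _ = s * (b + M * s) := by ring

/-- A shift-Lipschitz function with Lipschitz derivative has monotone Taylor expansions. -/
lemma ShiftLipschitz.hasMonotoneTaylor {n : ℕ} {I : Finset (Fin n)} {L M : ℝ}
    {F : (Fin n → ℝ) → ℝ} (hF : ShiftLipschitz I L F)
    (h0 : ∀ x, 0 ≤ F x) (h1 : ∀ x, F x ≤ 1) {F' : (Fin n → ℝ) → (Fin n → ℝ) →L[ℝ] ℝ}
    (hF' : ∀ x, HasFDerivAt F (F' x) x) (hM : ∀ x y, ‖F' y - F' x‖ ≤ M * ‖y - x‖) (hM0 : 0 ≤ M) :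
    HasMonotoneTaylor I L M F fun i x => F' x (Pi.single i 1) := by
  have htay : ∀ x v, |F (x + v) - F x - F' x v| ≤ M * ‖v‖ ^ 2 := by
    intro x v
    have := (convex_closedBall x ‖v‖).norm_image_sub_le_of_norm_hasFDerivWithin_le'
      (f := F) (f' := F') (φ := F' x) (C := M * ‖v‖) (x := x) (y := x + v)
      (fun y _ => (hF' y).hasFDerivWithinAt) (fun y hy => (hM x y).trans (by
        gcongr; simpa [dist_eq_norm] using hy)) (by simp) (by simp)
    simp only [add_sub_cancel_left, Real.norm_eq_abs] at this
    linarith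
  have hsum : ∀ x v, ∑ i, F' x (Pi.single i 1) * v i = F' x v := by
    intro x v
    conv_rhs => rw [pi_eq_sum_univ' v, map_sum]
    refine Finset.sum_congr rfl fun i _ => ?_
    rw [map_smul, smul_eq_mul, mul_comm]
  have hsingle : ∀ (i : Fin n) (s : ℝ), 0 < s → ‖s • (Pi.single i 1 : Fin n → ℝ)‖ = s := by
    intro i s hs
    rw [norm_smul, Pi.norm_single, norm_one, mul_one, Real.norm_of_nonneg hs.le]
  refine ⟨hF.lipschitzWith.continuous.measurable, h0, h1, fun i => ?_, fun i x => ?_,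
    fun i x hi => ?_, fun x => ?_, fun x v => ?_⟩
  · have : LipschitzWith M.toNNReal F' := LipschitzWith.of_dist_le_mul fun y x => by
      rw [dist_eq_norm, dist_eq_norm, Real.coe_toNNReal _ hM0]; exact hM x y
    exact (this.continuous.clm_apply continuous_const).measurable
  · refine le_of_mul_le_mul_add_sq (M := M) fun s hs => ?_
    have h := htay x (s • Pi.single i 1)
    rw [hsingle i s hs, map_smul, smul_eq_mul] at h
    have hmono : F x ≤ F (x + s • Pi.single i 1) + L * 0 := hF le_rfl fun j _ => by
      have : 0 ≤ (Pi.single i 1 : Fin n → ℝ) j := by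
        by_cases hj : j = i
        · subst hj; simp
        · simp [hj]
      simp only [Pi.add_apply, Pi.smul_apply, smul_eq_mul]
      nlinarith
    linarith [(abs_le.1 h).2]
  · have hoff : ∀ s : ℝ, 0 < s → F (x + s • Pi.single i 1) = F x := by
      intro s hs
      have hj : ∀ j ∈ I, (x + s • (Pi.single i 1 : Fin n → ℝ)) j = x j := fun j hj => by
        have : j ≠ i := fun h => hi (h ▸ hj)
        simp [this]
      refine le_antisymm ?_ ?_
      · simpa using hF (x := x + s • Pi.single i 1) (y := x) le_rfl
          fun j hj' => by simpa using (hj j hj').le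
      · simpa using hF (y := x + s • Pi.single i 1) (x := x) le_rfl
          fun j hj' => by simpa using (hj j hj').ge
    refine le_antisymm ?_ ?_ <;> refine le_of_mul_le_mul_add_sq (M := M) fun s hs => ?_ <;>
    · have h := htay x (s • Pi.single i 1)
      rw [hsingle i s hs, map_smul, smul_eq_mul, hoff s hs] at h
      obtain ⟨h1, h2⟩ := abs_le.1 h
      linarith
  -- The mass of the gradient is the derivative along the diagonal, where the growth rate is at most
  -- `L`.
  · have hone : ∑ i, F' x (Pi.single i 1) = F' x 1 := by simpa using hsum x 1
    rw [hone]
    refine le_of_mul_le_mul_add_sq (M := M) fun s hs => ?_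
    have h := htay x (s • 1)
    rw [map_smul, smul_eq_mul] at h
    have hnorm : ‖s • (1 : Fin n → ℝ)‖ ≤ s := by
      rw [pi_norm_le_iff_of_nonneg hs.le]
      intro i
      simp [abs_of_pos hs]
    have hle : M * ‖s • (1 : Fin n → ℝ)‖ ^ 2 ≤ M * s ^ 2 := by gcongr
    have hgrow : F (x + s • 1) ≤ F x + L * s := hF hs.le fun j _ => by simp
    linarith [(abs_le.1 h).1]
  · rw [hsum]; exact htay x v

open ContinuousLinearMap in
/-- Shift-Lipschitz functions are uniformly approximated by functions with monotone Taylor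
expansions. -/
lemma ShiftLipschitz.exists_hasMonotoneTaylor {n : ℕ} {I : Finset (Fin n)} {L : ℝ} (hL : 0 ≤ L)
    {F : (Fin n → ℝ) → ℝ} (hF : ShiftLipschitz I L F)
    (h0 : ∀ x, 0 ≤ F x) (h1 : ∀ x, F x ≤ 1) {δ : ℝ} (hδ : 0 < δ) :
    ∃ G M ℓ, HasMonotoneTaylor I L M G ℓ ∧ 0 ≤ M ∧ ∀ x, |G x - F x| ≤ δ := by
  have hcont : Continuous F := hF.lipschitzWith.continuous
  -- Mollifying at this radius moves `F` by at most `L * δ / (L + 1) ≤ δ`; the `+ 1` covers `L = 0`.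
  have hr : 0 < δ / (L + 1) := by positivity
  let φ : ContDiffBump (0 : Fin n → ℝ) := ⟨δ / (L + 1) / 2, δ / (L + 1), by linarith, by linarith⟩
  set ψ := φ.normed volume with hψ
  have hψc : Continuous ψ := φ.continuous_normed
  have hψs : HasCompactSupport ψ := φ.hasCompactSupport_normed
  have hψd : ContDiff ℝ 1 ψ := φ.contDiff_normed
  set G := convolution ψ F (lsmul ℝ ℝ) volume with hG
  have hGe : ∀ x, G x = ∫ t, ψ t * F (x - t) := fun x => rfl
  have hint : ∀ x, Integrable fun t => ψ t * F (x - t) := fun x =>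
    (hψc.mul (hcont.comp (continuous_const.sub continuous_id))).integrable_of_hasCompactSupport
      hψs.mul_right
  have hψi : Integrable ψ := hψc.integrable_of_hasCompactSupport hψs
  have hψ1 : ∫ t, ψ t = 1 := φ.integral_normed
  have hψ0 : ∀ t, 0 ≤ ψ t := fun t => φ.nonneg_normed t
  have hD : ∀ x, HasFDerivAt G ((convolution (fderiv ℝ ψ) F
      ((lsmul ℝ ℝ).precompL (Fin n → ℝ)) volume) x) x := fun x =>
    hψs.hasFDerivAt_convolution_left _ hψd hcont.locallyIntegrable x
  have hψ'c : Continuous (fderiv ℝ ψ) := hψd.continuous_fderiv one_ne_zero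
  have hψ's : HasCompactSupport (fderiv ℝ ψ) := hψs.fderiv ℝ
  set B := (lsmul ℝ ℝ : ℝ →L[ℝ] ℝ →L[ℝ] ℝ).precompL (Fin n → ℝ)
  have hint' : ∀ x, Integrable fun t => B (fderiv ℝ ψ t) (F (x - t)) := fun x =>
    hψ's.convolutionExists_left B hψ'c hcont.locallyIntegrable x
  -- The derivative of `G` falls on the bump, so the Lipschitz bound on `F` makes it Lipschitz with
  -- this constant.
  refine ⟨G, L * ∫ t, ‖fderiv ℝ ψ t‖, _, ShiftLipschitz.hasMonotoneTaylor ?_ ?_ ?_ hD ?_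
    ?_, ?_, fun x => ?_⟩
  · intro x y s hs hxy
    rw [hGe, hGe]
    calc ∫ t, ψ t * F (x - t) ≤ ∫ t, (ψ t * F (y - t) + ψ t * (L * s)) := by
          refine integral_mono (hint x) ((hint y).add (hψi.mul_const _)) fun t => ?_
          simp only [← mul_add]
          exact mul_le_mul_of_nonneg_left (hF hs fun i hi => by
            simp only [Pi.sub_apply]; linarith [hxy i hi]) (hψ0 t)
      _ = _ := by rw [integral_add (hint y) (hψi.mul_const _), integral_mul_const, hψ1, one_mul]
  · exact fun x => integral_nonneg fun t => mul_nonneg (hψ0 t) (h0 _)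
  · intro x
    rw [hGe, ← hψ1]
    exact integral_mono (hint x) hψi fun t => mul_le_of_le_one_right (hψ0 t) (h1 _)
  · intro x y
    rw [convolution_def, convolution_def, ← integral_sub (hint' y) (hint' x)]
    have hb : ∀ t, ‖B (fderiv ℝ ψ t) (F (y - t)) - B (fderiv ℝ ψ t) (F (x - t))‖
        ≤ ‖fderiv ℝ ψ t‖ * (L * ‖y - x‖) := by
      intro t
      rw [← map_sub]
      have e : ∀ a, B (fderiv ℝ ψ t) a = a • fderiv ℝ ψ t := fun a => by
        ext g; simp [B, precompL_apply, mul_comm]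
      rw [e, norm_smul, mul_comm]
      gcongr
      have := hF.lipschitzWith.dist_le_mul (y - t) (x - t)
      rwa [Real.coe_toNNReal _ hL, dist_eq_norm, dist_eq_norm, sub_sub_sub_cancel_right] at this
    have hi : Integrable fun t => ‖fderiv ℝ ψ t‖ :=
      (hψ'c.integrable_of_hasCompactSupport hψ's).norm
    refine (norm_integral_le_of_norm_le (hi.mul_const _)
      (.of_forall hb)).trans (le_of_eq ?_)
    rw [integral_mul_const]
    ring
  · have : 0 ≤ ∫ t, ‖fderiv ℝ ψ t‖ := integral_nonneg fun t => norm_nonneg _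
    positivity
  · have : 0 ≤ ∫ t, ‖fderiv ℝ ψ t‖ := integral_nonneg fun t => norm_nonneg _
    positivity
  · have := φ.dist_normed_convolution_le (μ := volume) (g := F) (x₀ := x) (ε := δ)
      hcont.aestronglyMeasurable fun y hy => by
        refine (hF.lipschitzWith.dist_le_mul y x).trans ?_
        rw [Real.coe_toNNReal _ hL]
        have h2 : dist y x ≤ δ / (L + 1) := (Metric.mem_ball.1 hy).le
        calc L * dist y x ≤ L * (δ / (L + 1)) := by gcongr
          _ ≤ δ := by
            rw [mul_div_assoc', div_le_iff₀ (by positivity)]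
            nlinarith
    rwa [Real.dist_eq] at this

/-! ### Covariance under convolution and under a small perturbation -/

lemma abs_covariance_le_integral_sq {α : Type*} [MeasurableSpace α] {μ : Measure α}
    [IsProbabilityMeasure μ] {X Y B : α → ℝ} (hX : MemLp X 2 μ) (hY : MemLp Y 2 μ)
    (hB : MemLp B 2 μ) (hXB : ∀ a, |X a| ≤ B a) (hYB : ∀ a, |Y a| ≤ B a) :
    |cov[X, Y; μ]| ≤ ∫ a, B a ^ 2 ∂μ := by
  have hvar : ∀ {Z : α → ℝ}, MemLp Z 2 μ → (∀ a, |Z a| ≤ B a) →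
      ∫ a, (Z a - μ[Z]) ^ 2 ∂μ ≤ ∫ a, B a ^ 2 ∂μ := by
    intro Z hZ hZB
    rw [← variance_eq_integral hZ.aemeasurable]
    refine (variance_le_expectation_sq hZ.aestronglyMeasurable).trans ?_
    refine integral_mono hZ.integrable_sq hB.integrable_sq fun a => ?_
    simpa using sq_le_sq' (by linarith [(abs_le.1 (hZB a)).1]) ((abs_le.1 (hZB a)).2)
  have hX' : Integrable (fun a => (X a - μ[X]) ^ 2) μ :=
    (hX.sub (memLp_const _)).integrable_sq
  have hY' : Integrable (fun a => (Y a - μ[Y]) ^ 2) μ :=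
    (hY.sub (memLp_const _)).integrable_sq
  calc |cov[X, Y; μ]| ≤ ∫ a, ((X a - μ[X]) ^ 2 + (Y a - μ[Y]) ^ 2) / 2 ∂μ := by
        rw [covariance, ← Real.norm_eq_abs]
        refine norm_integral_le_of_norm_le ((hX'.add hY').div_const 2) (.of_forall fun a => ?_)
        rw [Real.norm_eq_abs, abs_le]
        constructor
        · nlinarith [sq_nonneg (X a - μ[X] + (Y a - μ[Y]))]
        · nlinarith [sq_nonneg (X a - μ[X] - (Y a - μ[Y]))]
    _ = ((∫ a, (X a - μ[X]) ^ 2 ∂μ) + ∫ a, (Y a - μ[Y]) ^ 2 ∂μ) / 2 := by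
        rw [integral_div, integral_add hX' hY']
    _ ≤ _ := by linarith [hvar hX hXB, hvar hY hYB]

/-- Law of total covariance for a sum of two independent vectors, conditioning on the one with law
`ν`. -/
lemma covariance_conv {n : ℕ} {ν ρ : Measure (Fin n → ℝ)} [IsProbabilityMeasure ν]
    [IsProbabilityMeasure ρ] {F G : (Fin n → ℝ) → ℝ} (hF : Measurable F) (hG : Measurable G)
    (hF0 : ∀ x, 0 ≤ F x) (hF1 : ∀ x, F x ≤ 1) (hG0 : ∀ x, 0 ≤ G x) (hG1 : ∀ x, G x ≤ 1) :
    cov[F, G; ν ∗ ρ] = ∫ x, cov[fun y => F (x + y), fun y => G (x + y); ρ] ∂ν +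
      cov[fun x => ∫ y, F (x + y) ∂ρ, fun x => ∫ y, G (x + y) ∂ρ; ν] := by
  have hmem : ∀ {μ : Measure (Fin n → ℝ)} [IsProbabilityMeasure μ] {f : (Fin n → ℝ) → ℝ},
      Measurable f → (∀ x, 0 ≤ f x) → (∀ x, f x ≤ 1) → MemLp f 2 μ := fun hf h0 h1 =>
    MemLp.of_bound hf.aestronglyMeasurable 1 (.of_forall fun x => by
      rw [Real.norm_of_nonneg (h0 x)]; exact h1 x)
  have hm : ∀ {f : (Fin n → ℝ) → ℝ}, Measurable f →
      Measurable fun x => ∫ y, f (x + y) ∂ρ := fun {f} hf =>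
    (StronglyMeasurable.integral_prod_right (f := fun x y => f (x + y))
      (hf.comp measurable_add).stronglyMeasurable).measurable
  have hi0 : ∀ {f : (Fin n → ℝ) → ℝ}, (∀ x, 0 ≤ f x) → ∀ x, 0 ≤ ∫ y, f (x + y) ∂ρ :=
    fun h0 x => integral_nonneg fun y => h0 _
  have hi1 : ∀ {f : (Fin n → ℝ) → ℝ}, Measurable f → (∀ x, 0 ≤ f x) → (∀ x, f x ≤ 1) →
      ∀ x, ∫ y, f (x + y) ∂ρ ≤ 1 := fun hf h0 h1 x => by
    simpa using integral_mono (integrable_of_mem_Icc (μ := ρ)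
      (hf.comp (measurable_const_add x)).aestronglyMeasurable (fun y => h0 (x + y))
      fun y => h1 (x + y)) (integrable_const 1) fun y => h1 (x + y)
  have hFG : Measurable (F * G) := hF.mul hG
  have hFG0 : ∀ x, 0 ≤ (F * G) x := fun x => mul_nonneg (hF0 x) (hG0 x)
  have hFG1 : ∀ x, (F * G) x ≤ 1 := fun x => mul_le_one₀ (hF1 x) (hG0 x) (hG1 x)
  have hconv : ∀ {f : (Fin n → ℝ) → ℝ}, Measurable f → (∀ x, 0 ≤ f x) → (∀ x, f x ≤ 1) →
      ∫ x, f x ∂(ν ∗ ρ) = ∫ x, ∫ y, f (x + y) ∂ρ ∂ν := fun hf h0 h1 =>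
    integral_conv (integrable_of_mem_Icc hf.aestronglyMeasurable h0 h1)
  rw [covariance_eq_sub (hmem hF hF0 hF1) (hmem hG hG0 hG1), hconv hFG hFG0 hFG1,
    hconv hF hF0 hF1, hconv hG hG0 hG1,
    covariance_eq_sub (hmem (hm hF) (hi0 hF0) (hi1 hF hF0 hF1))
      (hmem (hm hG) (hi0 hG0) (hi1 hG hG0 hG1))]
  have hx : ∀ x, cov[fun y => F (x + y), fun y => G (x + y); ρ] =
      (∫ y, (F * G) (x + y) ∂ρ) - (∫ y, F (x + y) ∂ρ) * ∫ y, G (x + y) ∂ρ := fun x =>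
    covariance_eq_sub
      (hmem (hF.comp (measurable_const_add x)) (fun y => hF0 (x + y)) fun y => hF1 (x + y))
      (hmem (hG.comp (measurable_const_add x)) (fun y => hG0 (x + y)) fun y => hG1 (x + y))
  simp only [hx]
  rw [integral_sub]
  · simp
  · exact integrable_of_mem_Icc (hm hFG).aestronglyMeasurable (hi0 hFG0) (hi1 hFG hFG0 hFG1)
  · exact integrable_of_mem_Icc ((hm hF).mul (hm hG)).aestronglyMeasurable (b := 1)
      (fun x => mul_nonneg (hi0 hF0 x) (hi0 hG0 x))
      fun x => mul_le_one₀ (hi1 hF hF0 hF1 x) (hi0 hG0 x) (hi1 hG hG0 hG1 x)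

section Step

variable {n : ℕ} {I J : Finset (Fin n)} {L L' M M' κ : ℝ} {F G : (Fin n → ℝ) → ℝ}
  {ℓ m : Fin n → (Fin n → ℝ) → ℝ}

lemma HasMonotoneTaylor.nonneg_const (h : HasMonotoneTaylor I L M F ℓ) : 0 ≤ L :=
  (Finset.sum_nonneg fun i _ => h.grad_nonneg i 0).trans (h.sum_grad_le 0)

lemma memLp_one_add_norm_sq {μ : Measure (Fin n → ℝ)} [IsProbabilityMeasure μ]
    (hμ : MemLp id 4 μ) : MemLp (fun v => 1 + ‖v‖ ^ 2) 2 μ := by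
  suffices h : MemLp (fun v : Fin n → ℝ => ‖v‖ ^ 2) 2 μ from (memLp_const (1 : ℝ)).add h
  have h4 : MemLp (id : (Fin n → ℝ) → Fin n → ℝ) (4 : ℕ) μ := by exact_mod_cast hμ
  rw [memLp_two_iff_integrable_sq (by fun_prop)]
  refine (h4.integrable_norm_pow (by norm_num)).congr (.of_forall fun v => ?_)
  simp only [id]
  ring

/-- For a small perturbation, the covariance is controlled by the
covariances of the coordinates, up to a higher order term. -/
lemma abs_covariance_scaled_le {μ : Measure (Fin n → ℝ)} [IsProbabilityMeasure μ]
    (hμ : MemLp id 4 μ) (hF : HasMonotoneTaylor I L M F ℓ) (hG : HasMonotoneTaylor J L' M' G m)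
    (hM : 0 ≤ M) (hM' : 0 ≤ M') (hκ : 0 ≤ κ)
    (hcov : ∀ i ∈ I, ∀ j ∈ J, |cov[fun v => v i, fun v => v j; μ]| ≤ κ)
    {η : ℝ} (hη : 0 < η) (hη1 : η ≤ 1) (x : Fin n → ℝ) :
    |cov[fun v => F (x + η • v), fun v => G (x + η • v); μ]| ≤
      η ^ 2 * (κ * (L * L')) +
        η ^ 3 * (3 * ∫ v, ((L + L' + M + M') * (1 + ‖v‖ ^ 2)) ^ 2 ∂μ) := by
  have hL := hF.nonneg_const
  have hL' := hG.nonneg_const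
  -- A common majorant of the linear parts and of the remainders divided by `η ^ 2`. It depends on
  -- neither `x` nor `η`, and its square is integrable by the fourth moment.
  set B : (Fin n → ℝ) → ℝ := fun v => (L + L' + M + M') * (1 + ‖v‖ ^ 2) with hBdef
  have hB : MemLp B 2 μ := (memLp_one_add_norm_sq hμ).const_mul _
  set S := ∫ v, B v ^ 2 ∂μ with hS
  have hS0 : 0 ≤ S := integral_nonneg fun v => sq_nonneg _
  have hmem : ∀ {f : (Fin n → ℝ) → ℝ}, Measurable f → (∀ v, |f v| ≤ B v) → MemLp f 2 μ :=
    fun hf hb => hB.mono hf.aestronglyMeasurable (.of_forall fun v =>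
      (hb v).trans (le_abs_self _))
  have hlin : ∀ {K N : ℝ}, 0 ≤ K → 0 ≤ N → K + N ≤ L + L' + M + M' →
      ∀ v : Fin n → ℝ, K * ‖v‖ + N * ‖v‖ ^ 2 ≤ B v := by
    intro K N hK hN hKN v
    have h1 : ‖v‖ ≤ 1 + ‖v‖ ^ 2 := by nlinarith [sq_nonneg (‖v‖ - 1), norm_nonneg v]
    have h2 : ‖v‖ ^ 2 ≤ 1 + ‖v‖ ^ 2 := by linarith
    calc K * ‖v‖ + N * ‖v‖ ^ 2 ≤ K * (1 + ‖v‖ ^ 2) + N * (1 + ‖v‖ ^ 2) := by gcongr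
      _ = (K + N) * (1 + ‖v‖ ^ 2) := by ring
      _ ≤ _ := mul_le_mul_of_nonneg_right hKN (by positivity)
  set a : (Fin n → ℝ) → ℝ := fun v => ∑ i, ℓ i x * v i with ha
  set b : (Fin n → ℝ) → ℝ := fun v => ∑ i, m i x * v i with hb
  set r : (Fin n → ℝ) → ℝ := fun v => (F (x + η • v) - F x - ∑ i, ℓ i x * (η • v) i) / η ^ 2
    with hr
  set s : (Fin n → ℝ) → ℝ := fun v => (G (x + η • v) - G x - ∑ i, m i x * (η • v) i) / η ^ 2
    with hs
  have hFm := hF.measurable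
  have hGm := hG.measurable
  have haB : ∀ v, |a v| ≤ B v := fun v =>
    (hF.abs_sum_le x v).trans (by simpa using hlin (N := 0) hL le_rfl (by linarith) v)
  have hbB : ∀ v, |b v| ≤ B v := fun v =>
    (hG.abs_sum_le x v).trans (by simpa using hlin (N := 0) hL' le_rfl (by linarith) v)
  have hrem : ∀ {N t : ℝ} {v : Fin n → ℝ}, |t| ≤ N * ‖η • v‖ ^ 2 → |t / η ^ 2| ≤ N * ‖v‖ ^ 2 := by
    intro N t v h
    rw [norm_smul, Real.norm_of_nonneg hη.le, mul_pow] at h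
    rw [abs_div, abs_of_pos (pow_pos hη 2), div_le_iff₀ (pow_pos hη 2)]
    linarith
  have hrB : ∀ v, |r v| ≤ B v := fun v =>
    (hrem (hF.taylor x (η • v))).trans (by simpa using hlin (K := 0) le_rfl hM (by linarith) v)
  have hsB : ∀ v, |s v| ≤ B v := fun v =>
    (hrem (hG.taylor x (η • v))).trans (by simpa using hlin (K := 0) le_rfl hM' (by linarith) v)
  have ham : MemLp a 2 μ := hmem (by fun_prop) haB
  have hbm : MemLp b 2 μ := hmem (by fun_prop) hbB
  have hrm : MemLp r 2 μ := hmem (by fun_prop) hrB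
  have hsm : MemLp s 2 μ := hmem (by fun_prop) hsB
  have hFe : (fun v => F (x + η • v)) = fun v => F x + (η • a + η ^ 2 • r) v := by
    ext v
    have : ∑ i, ℓ i x * (η • v) i = η * ∑ i, ℓ i x * v i := by
      rw [Finset.mul_sum]; exact Finset.sum_congr rfl fun i _ => by simp; ring
    simp only [Pi.add_apply, Pi.smul_apply, smul_eq_mul, ha, hr] at this ⊢
    rw [this]; field_simp; ring
  have hGe : (fun v => G (x + η • v)) = fun v => G x + (η • b + η ^ 2 • s) v := by
    ext v
    have : ∑ i, m i x * (η • v) i = η * ∑ i, m i x * v i := by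
      rw [Finset.mul_sum]; exact Finset.sum_congr rfl fun i _ => by simp; ring
    simp only [Pi.add_apply, Pi.smul_apply, smul_eq_mul, hb, hs] at this ⊢
    rw [this]; field_simp; ring
  have hexp : cov[fun v => F (x + η • v), fun v => G (x + η • v); μ] =
      η ^ 2 * cov[a, b; μ] + η ^ 3 * (cov[a, s; μ] + cov[r, b; μ]) + η ^ 4 * cov[r, s; μ] := by
    have h1 := ham.const_smul η
    have h2 := hrm.const_smul (η ^ 2)
    have h3 := hbm.const_smul η
    have h4 := hsm.const_smul (η ^ 2)
    rw [hFe, hGe, covariance_const_add_left ((h1.add h2).integrable one_le_two),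
      covariance_const_add_right ((h3.add h4).integrable one_le_two),
      covariance_add_left h1 h2 (h3.add h4), covariance_add_right h1 h3 h4,
      covariance_add_right h2 h3 h4]
    simp only [covariance_smul_left, covariance_smul_right]
    ring
  have hab : |cov[a, b; μ]| ≤ κ * (L * L') := by
    have hcoord : ∀ i, MemLp (fun v : Fin n → ℝ => v i) 2 μ := fun i =>
      (hμ.mono_exponent (q := 4) (p := 2) (by norm_num)).eval i
    have : cov[a, b; μ] = ∑ i, ∑ j, ℓ i x * m j x * cov[fun v => v i, fun v => v j; μ] := by
      rw [ha, hb, covariance_fun_sum_fun_sum (fun i => (hcoord i).const_mul _)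
        fun j => (hcoord j).const_mul _]
      simp only [covariance_const_mul_left, covariance_const_mul_right, mul_assoc, mul_left_comm]
    rw [this]
    calc |∑ i, ∑ j, ℓ i x * m j x * cov[fun v => v i, fun v => v j; μ]|
        ≤ ∑ i, ∑ j, |ℓ i x * m j x * cov[fun v => v i, fun v => v j; μ]| :=
          (Finset.abs_sum_le_sum_abs _ _).trans
            (Finset.sum_le_sum fun i _ => Finset.abs_sum_le_sum_abs _ _)
      _ ≤ ∑ i, ∑ j, ℓ i x * m j x * κ := by
          refine Finset.sum_le_sum fun i _ => Finset.sum_le_sum fun j _ => ?_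
          by_cases hi : i ∈ I
          · by_cases hj : j ∈ J
            · have := mul_nonneg (hF.grad_nonneg i x) (hG.grad_nonneg j x)
              rw [abs_mul, abs_of_nonneg this]
              exact mul_le_mul_of_nonneg_left (hcov i hi j hj) this
            · simp [hG.grad_eq_zero j x hj]
          · simp [hF.grad_eq_zero i x hi]
      _ = κ * ((∑ i, ℓ i x) * ∑ j, m j x) := by
          rw [Finset.sum_mul_sum, mul_comm, Finset.sum_mul]
          exact Finset.sum_congr rfl fun i _ => by rw [Finset.sum_mul]
      _ ≤ κ * (L * L') := by
          gcongr
          · exact Finset.sum_nonneg fun j _ => hG.grad_nonneg j x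
          · exact hF.sum_grad_le x
          · exact hG.sum_grad_le x
  have h1 := abs_covariance_le_integral_sq ham hsm hB haB hsB
  have h2 := abs_covariance_le_integral_sq hrm hbm hB hrB hbB
  have h3 := abs_covariance_le_integral_sq hrm hsm hB hrB hsB
  -- Two cross terms of order `η ^ 3` and one remainder term of order `η ^ 4` make up the factor 3.
  have h43 : η ^ 4 ≤ η ^ 3 := pow_le_pow_of_le_one hη.le hη1 (by norm_num)
  rw [hexp]
  calc |η ^ 2 * cov[a, b; μ] + η ^ 3 * (cov[a, s; μ] + cov[r, b; μ]) + η ^ 4 * cov[r, s; μ]|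
      ≤ η ^ 2 * |cov[a, b; μ]| + η ^ 3 * (|cov[a, s; μ]| + |cov[r, b; μ]|)
          + η ^ 4 * |cov[r, s; μ]| := by
        refine (abs_add_le _ _).trans (add_le_add ((abs_add_le _ _).trans (add_le_add ?_ ?_)) ?_)
        · rw [abs_mul, abs_of_pos (pow_pos hη 2)]
        · rw [abs_mul, abs_of_pos (pow_pos hη 3)]
          gcongr
          exact abs_add_le _ _
        · rw [abs_mul, abs_of_pos (pow_pos hη 4)]
    _ ≤ η ^ 2 * (κ * (L * L')) + η ^ 3 * (S + S) + η ^ 3 * S := by gcongr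
    _ = _ := by ring

end Step

/-! ### Telescoping over small Gaussian increments -/

section Gaussian

variable {n : ℕ} {I J : Finset (Fin n)} {L L' M M' κ : ℝ} {F G : (Fin n → ℝ) → ℝ}
  {ℓ m : Fin n → (Fin n → ℝ) → ℝ}

lemma charFunDual_map_smul_of_centered {μ : Measure (Fin n → ℝ)} [IsGaussian μ] (hμ : μ[id] = 0)
    (c : ℝ) (T : StrongDual ℝ (Fin n → ℝ)) :
    charFunDual (μ.map fun v => c • v) T = Complex.exp (-(c ^ 2 * Var[T; μ] : ℝ) / 2) := by
  have h : (fun v : Fin n → ℝ => c • v) = ⇑(c • ContinuousLinearMap.id ℝ (Fin n → ℝ)) := rfl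
  rw [h, charFunDual_map, IsGaussian.charFunDual_eq_of_integral_eq_zero hμ]
  have h' : (⇑(T.comp (c • ContinuousLinearMap.id ℝ (Fin n → ℝ)))) = fun v => c * T v := by
    ext v; simp
  rw [h', variance_const_mul]

/-- A centred Gaussian measure is stable under convolution. -/
lemma map_smul_conv_map_smul {μ : Measure (Fin n → ℝ)} [IsGaussian μ] (hμ : μ[id] = 0)
    {a b c : ℝ} (h : c ^ 2 = a ^ 2 + b ^ 2) :
    μ.map (fun v => c • v) = μ.map (fun v => a • v) ∗ μ.map (fun v => b • v) := by
  have hp : ∀ t : ℝ, IsProbabilityMeasure (μ.map fun v => t • v) := fun t =>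
    Measure.isProbabilityMeasure_map (by fun_prop)
  have := hp a
  have := hp b
  have := hp c
  refine Measure.ext_of_charFunDual (funext fun T => ?_)
  rw [charFunDual_conv, charFunDual_map_smul_of_centered hμ, charFunDual_map_smul_of_centered hμ,
    charFunDual_map_smul_of_centered hμ, ← Complex.exp_add, h]
  congr 1
  push_cast
  ring

/-- The measure is the law of a sum of `k` independent copies scaled by `η`. Peeling one off leaves
a conditional covariance, bounded by the one-step estimate, and the covariance of averaged
functions. These keep the same constants, so the induction hypothesis, stated for all functions of
the class, applies. -/
lemma abs_covariance_map_smul_le {μ : Measure (Fin n → ℝ)} [IsGaussian μ] (hμ : μ[id] = 0)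
    (hM : 0 ≤ M) (hM' : 0 ≤ M') (hκ : 0 ≤ κ)
    (hcov : ∀ i ∈ I, ∀ j ∈ J, |cov[fun v => v i, fun v => v j; μ]| ≤ κ)
    {η : ℝ} (hη : 0 < η) (hη1 : η ≤ 1) (k : ℕ) :
    ∀ {F G : (Fin n → ℝ) → ℝ} {ℓ m : Fin n → (Fin n → ℝ) → ℝ},
      HasMonotoneTaylor I L M F ℓ → HasMonotoneTaylor J L' M' G m →
      |cov[F, G; μ.map fun v => (√k * η) • v]| ≤ k * (η ^ 2 * (κ * (L * L')) +
        η ^ 3 * (3 * ∫ v, ((L + L' + M + M') * (1 + ‖v‖ ^ 2)) ^ 2 ∂μ)) := by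
  have hp : ∀ t : ℝ, IsProbabilityMeasure (μ.map fun v => t • v) := fun t =>
    Measure.isProbabilityMeasure_map (by fun_prop)
  induction k with
  | zero =>
    intro F G ℓ m hF hG
    rw [covariance_map_fun hF.measurable.aestronglyMeasurable hG.measurable.aestronglyMeasurable
      (by fun_prop)]
    simp
  | succ k ih =>
    intro F G ℓ m hF hG
    have h1 := hp (√k * η)
    have h2 := hp η
    rw [map_smul_conv_map_smul (a := √k * η) (b := η) hμ (by
      rw [mul_pow, mul_pow, Real.sq_sqrt (by positivity), Real.sq_sqrt (by positivity)]
      push_cast; ring), covariance_conv hF.measurable hG.measurable hF.nonneg hF.le_one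
      hG.nonneg hG.le_one]
    have hstep : ∀ x, |cov[fun y => F (x + y), fun y => G (x + y); μ.map fun v => η • v]| ≤
        η ^ 2 * (κ * (L * L')) +
        η ^ 3 * (3 * ∫ v, ((L + L' + M + M') * (1 + ‖v‖ ^ 2)) ^ 2 ∂μ) := by
      intro x
      have hFm := hF.measurable
      have hGm := hG.measurable
      rw [covariance_map_fun (Measurable.aestronglyMeasurable (by fun_prop))
        (Measurable.aestronglyMeasurable (by fun_prop)) (by fun_prop)]
      exact abs_covariance_scaled_le (IsGaussian.memLp_id μ 4 (by norm_num)) hF hG hM hM' hκ hcov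
        hη hη1 x
    have hint := norm_integral_le_of_norm_le_const (μ := μ.map fun v => (√k * η) • v)
      (f := fun x => cov[fun y => F (x + y), fun y => G (x + y); μ.map fun v => η • v])
      (.of_forall hstep)
    rw [probReal_univ, mul_one, Real.norm_eq_abs] at hint
    have hih := ih (hF.average (μ.map fun v => η • v)) (hG.average (μ.map fun v => η • v))
    refine (abs_add_le _ _).trans ((add_le_add hint hih).trans (le_of_eq ?_))
    push_cast
    ring

/-- With `N` steps of size `1 / √N` the main terms add up to `κ * (L * L')` and the errors to `C /
√N`. The constants `M`, `M'` vanish in the limit, which is what lets the smoothness be removed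
afterwards. -/
lemma HasMonotoneTaylor.abs_covariance_le {μ : Measure (Fin n → ℝ)} [IsGaussian μ]
    (hμ : μ[id] = 0) (hF : HasMonotoneTaylor I L M F ℓ) (hG : HasMonotoneTaylor J L' M' G m)
    (hM : 0 ≤ M) (hM' : 0 ≤ M') (hκ : 0 ≤ κ)
    (hcov : ∀ i ∈ I, ∀ j ∈ J, |cov[fun v => v i, fun v => v j; μ]| ≤ κ) :
    |cov[F, G; μ]| ≤ κ * (L * L') := by
  set C := 3 * ∫ v, ((L + L' + M + M') * (1 + ‖v‖ ^ 2)) ^ 2 ∂μ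
  have hlim : Filter.Tendsto (fun N : ℕ => κ * (L * L') + (√N)⁻¹ * C) Filter.atTop
      (nhds (κ * (L * L') + 0 * C)) := by
    refine Filter.Tendsto.const_add _ (Filter.Tendsto.mul_const _ ?_)
    exact tendsto_inv_atTop_zero.comp
      (Real.tendsto_sqrt_atTop.comp tendsto_natCast_atTop_atTop)
  rw [zero_mul, add_zero] at hlim
  refine ge_of_tendsto hlim ?_
  filter_upwards [Filter.eventually_ge_atTop 1] with N hN
  have hN1 : (1 : ℝ) ≤ N := by exact_mod_cast hN
  have hs1 : 1 ≤ √(N : ℝ) := Real.one_le_sqrt.2 hN1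
  have hs : 0 < √(N : ℝ) := by linarith
  have h := abs_covariance_map_smul_le (L := L) (L' := L') hμ hM hM' hκ hcov (inv_pos.2 hs)
    (inv_le_one_of_one_le₀ hs1) N hF hG
  rw [mul_inv_cancel₀ hs.ne'] at h
  simp only [one_smul, Measure.map_id'] at h
  refine h.trans (le_of_eq ?_)
  have hNs : (N : ℝ) = √(N : ℝ) ^ 2 := (Real.sq_sqrt (by positivity)).symm
  calc (N : ℝ) * ((√N)⁻¹ ^ 2 * (κ * (L * L')) + (√N)⁻¹ ^ 3 * C)
      = √(N : ℝ) ^ 2 * ((√N)⁻¹ ^ 2 * (κ * (L * L')) + (√N)⁻¹ ^ 3 * C) := by rw [← hNs]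
    _ = _ := by field_simp

end Gaussian

/-! ### From smooth to Lipschitz functions, from centred to general Gaussians -/

/-- The identity `ab - cd = (a - c)b + c(b - d)` is used for the mean of the product and for the
product of the means, whence the factor 2. -/
lemma abs_covariance_sub_le {α : Type*} [MeasurableSpace α] {μ : Measure α}
    [IsProbabilityMeasure μ] {F G F' G' : α → ℝ} (hF : Measurable F) (hG : Measurable G)
    (hF' : Measurable F') (hG' : Measurable G')
    (hF0 : ∀ x, 0 ≤ F x) (hF1 : ∀ x, F x ≤ 1) (hG0 : ∀ x, 0 ≤ G x) (hG1 : ∀ x, G x ≤ 1)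
    (hF0' : ∀ x, 0 ≤ F' x) (hF1' : ∀ x, F' x ≤ 1) (hG0' : ∀ x, 0 ≤ G' x) (hG1' : ∀ x, G' x ≤ 1) :
    |cov[F, G; μ] - cov[F', G'; μ]| ≤
      2 * ((∫ x, |F x - F' x| ∂μ) + ∫ x, |G x - G' x| ∂μ) := by
  have hmem : ∀ {f : α → ℝ}, Measurable f → (∀ x, 0 ≤ f x) → (∀ x, f x ≤ 1) → MemLp f 2 μ :=
    fun hf h0 h1 => MemLp.of_bound hf.aestronglyMeasurable 1 (.of_forall fun x => by
      rw [Real.norm_of_nonneg (h0 x)]; exact h1 x)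
  have mF := hmem hF hF0 hF1
  have mG := hmem hG hG0 hG1
  have mF' := hmem hF' hF0' hF1'
  have mG' := hmem hG' hG0' hG1'
  have iF := mF.integrable one_le_two
  have iG := mG.integrable one_le_two
  have iF' := mF'.integrable one_le_two
  have iG' := mG'.integrable one_le_two
  have iFG : Integrable (F * G) μ := mF.integrable_mul mG
  have iFG' : Integrable (F' * G') μ := mF'.integrable_mul mG'
  have dF : |∫ x, F x ∂μ - ∫ x, F' x ∂μ| ≤ ∫ x, |F x - F' x| ∂μ := by
    rw [← integral_sub iF iF']; exact abs_integral_le_integral_abs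
  have dG : |∫ x, G x ∂μ - ∫ x, G' x ∂μ| ≤ ∫ x, |G x - G' x| ∂μ := by
    rw [← integral_sub iG iG']; exact abs_integral_le_integral_abs
  have hprod : ∀ {a b c d : ℝ}, 0 ≤ b → b ≤ 1 → 0 ≤ c → c ≤ 1 →
      |a * b - c * d| ≤ |a - c| + |b - d| := by
    intro a b c d hb hb1 hc hc1
    have : a * b - c * d = (a - c) * b + c * (b - d) := by ring
    rw [this]
    refine (abs_add_le _ _).trans (add_le_add ?_ ?_)
    · rw [abs_mul, abs_of_nonneg hb]; exact mul_le_of_le_one_right (abs_nonneg _) hb1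
    · rw [abs_mul, abs_of_nonneg hc]; exact mul_le_of_le_one_left (abs_nonneg _) hc1
  have dFG : |∫ x, (F * G) x ∂μ - ∫ x, (F' * G') x ∂μ| ≤
      (∫ x, |F x - F' x| ∂μ) + ∫ x, |G x - G' x| ∂μ := by
    have jF : Integrable (fun x => |F x - F' x|) μ := (iF.sub iF').abs
    have jG : Integrable (fun x => |G x - G' x|) μ := (iG.sub iG').abs
    rw [← integral_sub iFG iFG', ← integral_add jF jG]
    rw [← Real.norm_eq_abs]
    refine norm_integral_le_of_norm_le (jF.add jG) (.of_forall fun x => ?_)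
    exact hprod (hG0 x) (hG1 x) (hF0' x) (hF1' x)
  have hle1 : ∀ {f : α → ℝ}, Integrable f μ → (∀ x, f x ≤ 1) → ∫ x, f x ∂μ ≤ 1 := fun hi h1 => by
    simpa using integral_mono hi (integrable_const 1) h1
  have dPP : |(∫ x, F x ∂μ) * (∫ x, G x ∂μ) - (∫ x, F' x ∂μ) * ∫ x, G' x ∂μ| ≤
      (∫ x, |F x - F' x| ∂μ) + ∫ x, |G x - G' x| ∂μ :=
    (hprod (integral_nonneg hG0) (hle1 iG hG1) (integral_nonneg hF0') (hle1 iF' hF1')).trans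
      (add_le_add dF dG)
  rw [covariance_eq_sub mF mG, covariance_eq_sub mF' mG']
  rw [abs_le] at dFG dPP ⊢
  constructor <;> linarith [dFG.1, dFG.2, dPP.1, dPP.2]

lemma ShiftLipschitz.abs_covariance_le_of_centered {n : ℕ} {I J : Finset (Fin n)} {L L' κ : ℝ}
    {F G : (Fin n → ℝ) → ℝ} {μ : Measure (Fin n → ℝ)} [IsGaussian μ] (hμ : μ[id] = 0)
    (hL : 0 ≤ L) (hL' : 0 ≤ L') (hF : ShiftLipschitz I L F) (hG : ShiftLipschitz J L' G)
    (hF0 : ∀ x, 0 ≤ F x) (hF1 : ∀ x, F x ≤ 1) (hG0 : ∀ x, 0 ≤ G x) (hG1 : ∀ x, G x ≤ 1)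
    (hκ : 0 ≤ κ) (hcov : ∀ i ∈ I, ∀ j ∈ J, |cov[fun v => v i, fun v => v j; μ]| ≤ κ) :
    |cov[F, G; μ]| ≤ κ * (L * L') := by
  refine le_of_forall_pos_le_add fun δ hδ => ?_
  -- Uniform errors `δ / 4` in both functions change the covariance by at most `2 * (δ / 4 + δ / 4)
  -- = δ`.
  obtain ⟨F', M, ℓ, hF', hM, hFd⟩ :=
    hF.exists_hasMonotoneTaylor hL hF0 hF1 (δ := δ / 4) (by positivity)
  obtain ⟨G', M', m, hG', hM', hGd⟩ :=
    hG.exists_hasMonotoneTaylor hL' hG0 hG1 (δ := δ / 4) (by positivity)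
  have h := hF'.abs_covariance_le hμ hG' hM hM' hκ hcov
  have hFm := hF.lipschitzWith.continuous.measurable
  have hGm := hG.lipschitzWith.continuous.measurable
  have hd := abs_covariance_sub_le (μ := μ) hFm hGm
    hF'.measurable hG'.measurable hF0 hF1 hG0 hG1 hF'.nonneg hF'.le_one hG'.nonneg hG'.le_one
  have hint : ∀ {f g : (Fin n → ℝ) → ℝ}, (∀ x, |g x - f x| ≤ δ / 4) →
      ∫ x, |f x - g x| ∂μ ≤ δ / 4 := fun {f g} hfg => by
    refine (le_abs_self _).trans ?_
    have := norm_integral_le_of_norm_le_const (μ := μ) (f := fun x => |f x - g x|) (C := δ / 4)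
      (.of_forall fun x => by rw [norm_abs_eq_norm, norm_sub_rev]; exact hfg x)
    simpa using this
  have h1 := hint hFd
  have h2 := hint hGd
  have h3 := abs_sub_abs_le_abs_sub (cov[F, G; μ]) (cov[F', G'; μ])
  linarith

/-- The covariance of two shift-Lipschitz functions of a Gaussian vector is controlled by the
largest covariance between their coordinates. -/
lemma ShiftLipschitz.abs_covariance_le {n : ℕ} {I J : Finset (Fin n)} {L L' κ : ℝ}
    {F G : (Fin n → ℝ) → ℝ} {μ : Measure (Fin n → ℝ)} [IsGaussian μ]
    (hL : 0 ≤ L) (hL' : 0 ≤ L') (hF : ShiftLipschitz I L F) (hG : ShiftLipschitz J L' G)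
    (hF0 : ∀ x, 0 ≤ F x) (hF1 : ∀ x, F x ≤ 1) (hG0 : ∀ x, 0 ≤ G x) (hG1 : ∀ x, G x ≤ 1)
    (hκ : 0 ≤ κ) (hcov : ∀ i ∈ I, ∀ j ∈ J, |cov[fun v => v i, fun v => v j; μ]| ≤ κ) :
    |cov[F, G; μ]| ≤ κ * (L * L') := by
  set e := μ[id] with he
  set μ₀ := μ.map fun v => v - e with hμ₀
  have hid : Integrable (id : (Fin n → ℝ) → Fin n → ℝ) μ := IsGaussian.integrable_id
  have h0 : μ₀[id] = 0 := by
    rw [hμ₀, integral_map (by fun_prop) (by fun_prop)]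
    change ∫ v, (id v - e) ∂μ = 0
    rw [integral_sub hid (integrable_const e)]
    simp [he]
  have hg : IsGaussian μ₀ := by rw [hμ₀]; infer_instance
  have hback : μ₀.map (fun v => v + e) = μ := by
    rw [hμ₀, Measure.map_map (by fun_prop) (by fun_prop)]
    simp [Function.comp_def]
  have hFm := hF.lipschitzWith.continuous.measurable
  have hGm := hG.lipschitzWith.continuous.measurable
  rw [← hback, covariance_map_fun hFm.aestronglyMeasurable hGm.aestronglyMeasurable (by fun_prop)]
  refine ShiftLipschitz.abs_covariance_le_of_centered (I := I) (J := J) h0 hL hL'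
    (fun x y s hs h => hF hs fun i hi => ?_) (fun x y s hs h => hG hs fun i hi => ?_)
    (fun x => hF0 _) (fun x => hF1 _) (fun x => hG0 _) (fun x => hG1 _) hκ fun i hi j hj => ?_
  · simp only [Pi.add_apply]; linarith [h i hi]
  · simp only [Pi.add_apply]; linarith [h i hi]
  · have hi' : ∀ i, Integrable (fun v : Fin n → ℝ => v i) μ := fun i => hid.eval i
    rw [hμ₀, covariance_map_fun (measurable_pi_apply i).aestronglyMeasurable
      (measurable_pi_apply j).aestronglyMeasurable (by fun_prop)]
    simp only [Pi.sub_apply]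
    rw [covariance_sub_const_left (hi' i), covariance_sub_const_right (hi' j)]
    exact hcov i hi j hj

/-! ### Cost of a diagonal shift -/

lemma gaussianPDFReal_le_of_abs_sub_le {m : ℝ} {v : ℝ≥0} {x y : ℝ} (h : |x - m| ≤ |y - m|) :
    gaussianPDFReal m v y ≤ gaussianPDFReal m v x := by
  simp only [gaussianPDFReal]
  gcongr ?_ * Real.exp (?_ / _)
  have := sq_le_sq.2 h
  linarith

lemma gaussianPDFReal_le_inv_sqrt (m : ℝ) (v : ℝ≥0) (x : ℝ) :
    gaussianPDFReal m v x ≤ (√v)⁻¹ := by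
  rcases eq_or_ne v 0 with rfl | hv
  · simp
  refine (gaussianPDFReal_le_of_abs_sub_le (x := m) (by simp)).trans ?_
  have hv' : (0 : ℝ) < v := by positivity
  simp only [gaussianPDFReal, sub_self, ne_eq, OfNat.ofNat_ne_zero, not_false_eq_true, zero_pow,
    neg_zero, zero_div, Real.exp_zero, mul_one]
  gcongr
  nlinarith [Real.pi_gt_three]

/-- A translation by `ε` changes the integral of a function valued in `[0, 1]` against a Gaussian
of variance `v` by at most `ε / √v`. -/
lemma integral_gaussianReal_sub_shift_le {m ε : ℝ} {v : ℝ≥0} (hv : v ≠ 0) (hε : 0 ≤ ε)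
    {φ : ℝ → ℝ} (hφ : Measurable φ) (h0 : ∀ z, 0 ≤ φ z) (h1 : ∀ z, φ z ≤ 1) :
    ∫ z, φ z ∂(gaussianReal m v) - ∫ z, φ (z - ε) ∂(gaussianReal m v) ≤ ε / √v := by
  set p := gaussianPDFReal m v with hp
  have hpi : Integrable p := integrable_gaussianPDFReal m v
  have hpe : Integrable fun z => p (z + ε) := hpi.comp_add_right ε
  have hmul : ∀ {f : ℝ → ℝ}, Integrable f → Integrable fun z => f z * φ z := fun hf =>
    hf.mul_bdd (c := 1) hφ.aestronglyMeasurable (.of_forall fun z => by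
      rw [Real.norm_of_nonneg (h0 z)]; exact h1 z)
  rw [integral_gaussianReal_eq_integral_smul hv, integral_gaussianReal_eq_integral_smul hv]
  simp only [smul_eq_mul, ← hp]
  rw [← integral_add_right_eq_self (fun z => p z * φ (z - ε)) ε]
  simp only [add_sub_cancel_right]
  rw [← integral_sub (hmul hpi) (hmul hpe)]
  -- The densities `p z` and `p (z + ε)` cross at `m - ε / 2`, so the worst `φ` is the indicator of
  -- the half-line beyond it. Undoing the shift leaves the mass of `p` on an interval of length `ε`.
  set a : ℝ → ℝ := (Set.Ioi (m - ε / 2)).indicator p with ha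
  set b : ℝ → ℝ := (Set.Ioi (m + ε / 2)).indicator p with hb
  have hai : Integrable a := hpi.indicator measurableSet_Ioi
  have hbi : Integrable b := hpi.indicator measurableSet_Ioi
  have hbe : Integrable fun z => b (z + ε) := hbi.comp_add_right ε
  calc ∫ z, (p z * φ z - p (z + ε) * φ z)
      ≤ ∫ z, (a z - b (z + ε)) := by
        refine integral_mono ((hmul hpi).sub (hmul hpe)) (hai.sub hbe) fun z => ?_
        simp only [ha, hb, Set.indicator_apply, Set.mem_Ioi]
        by_cases hz : m - ε / 2 < z
        · rw [if_pos hz, if_pos (by linarith)]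
          have : p (z + ε) ≤ p z := gaussianPDFReal_le_of_abs_sub_le
            (abs_le_abs (by linarith) (by linarith))
          nlinarith [h1 z]
        · rw [if_neg hz, if_neg (by linarith)]
          have : p z ≤ p (z + ε) := gaussianPDFReal_le_of_abs_sub_le (by
            rw [abs_sub_comm z m, abs_of_nonneg (show 0 ≤ m - z by linarith)]
            exact abs_le.2 ⟨by linarith, by linarith⟩)
          nlinarith [h0 z]
    _ = ∫ z, (a z - b z) := by
        rw [integral_sub hai hbe, integral_add_right_eq_self b ε, integral_sub hai hbi]
    _ ≤ ∫ z, (Set.Ioc (m - ε / 2) (m + ε / 2)).indicator (fun _ => (√v)⁻¹) z := by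
        refine integral_mono (hai.sub hbi) ?_ fun z => ?_
        · exact (integrable_indicator_iff measurableSet_Ioc).2 (by simp)
        · simp only [ha, hb, Set.indicator_apply, Set.mem_Ioi, Set.mem_Ioc]
          by_cases hz : m - ε / 2 < z
          · by_cases hz' : m + ε / 2 < z
            · simp [hz, hz', not_le.2 hz']
            · simpa [hz, hz', not_lt.1 hz'] using gaussianPDFReal_le_inv_sqrt m v z
          · have hz' : ¬ m + ε / 2 < z := by linarith
            simp [hz, hz']
    _ = ε / √v := by
        rw [integral_indicator measurableSet_Ioc, setIntegral_const, measureReal_def,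
          Real.volume_Ioc, ENNReal.toReal_ofReal (by linarith), smul_eq_mul, div_eq_mul_inv]
        ring

/-- If a probability vector `w` on `I` has energy `q` and potential at least `q` on `I`, then
diagonal translation by `ε` changes the mean of a shift-Lipschitz function by at most `ε / √q`. -/
lemma ShiftLipschitz.integral_sub_shift_le {n : ℕ} {I : Finset (Fin n)} {L ε q : ℝ}
    {F : (Fin n → ℝ) → ℝ} {μ : Measure (Fin n → ℝ)} [IsGaussian μ] (hF : ShiftLipschitz I L F)
    (h0 : ∀ x, 0 ≤ F x) (h1 : ∀ x, F x ≤ 1) (hε : 0 ≤ ε) (w : I → ℝ)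
    (hq : ∑ i : I, ∑ j : I, w i * cov[fun v => v i, fun v => v j; μ] * w j = q) (hq0 : 0 < q)
    (hpot : ∀ i : I, q ≤ ∑ j : I, cov[fun v => v i, fun v => v j; μ] * w j) :
    ∫ v, F v ∂μ - ∫ v, F (v - fun _ => ε) ∂μ ≤ ε / √q := by
  have hFc := hF.lipschitzWith.continuous
  have hcoord : ∀ i, MemLp (fun v : Fin n → ℝ => v i) 2 μ := fun i =>
    IsGaussian.memLp_two_id.eval i
  have hwc : ∀ i : I, MemLp (fun v : Fin n → ℝ => w i * v i) 2 μ := fun i =>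
    (hcoord i).const_mul _
  set T : StrongDual ℝ (Fin n → ℝ) := ∑ i : I, w i • ContinuousLinearMap.proj (i : Fin n) with hT
  have hTv : ⇑T = fun v => ∑ i : I, w i * v i := by
    ext v; simp [hT]
  have hcovT : ∀ j, cov[fun v => v j, T; μ] = ∑ i : I, cov[fun v => v j, fun v => v i; μ] * w i := by
    intro j
    rw [hTv, covariance_fun_sum_right hwc (hcoord j)]
    simp only [covariance_const_mul_right, mul_comm]
  have hTm : MemLp T 2 μ := IsGaussian.memLp_dual μ T 2 (by norm_num)
  have hvar : Var[T; μ] = q := by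
    rw [← covariance_self (by fun_prop), ← hq]
    conv_lhs => rw [show cov[T, T; μ] = cov[fun v => ∑ i : I, w i * v i, T; μ] by rw [← hTv]]
    rw [covariance_fun_sum_left hwc hTm]
    refine Finset.sum_congr rfl fun i _ => ?_
    rw [covariance_const_mul_left, hcovT, Finset.mul_sum]
    exact Finset.sum_congr rfl fun j _ => by ring
  -- Regression coefficients on `T`: the residual `R` is uncorrelated with `T`, hence independent of
  -- it, and the bound on the potential says `h ≥ 1` on `I`.
  set h : Fin n → ℝ := fun j => cov[fun v => v j, T; μ] / q with hh
  have hh1 : ∀ i ∈ I, 1 ≤ h i := fun i hi => by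
    rw [hh, one_le_div hq0, hcovT]; exact hpot ⟨i, hi⟩
  set R : (Fin n → ℝ) →L[ℝ] (Fin n → ℝ) := ContinuousLinearMap.id ℝ _ - T.smulRight h with hR
  have hRv : ∀ v, R v = v - T v • h := fun v => by simp [hR]
  have hdec : ∀ v, R v + T v • h = v := fun v => by rw [hRv]; abel
  have hind : IndepFun R T μ := by
    have hlaw : HasGaussianLaw (fun v => (fun i => R v i, fun _ : Unit => T v)) μ :=
      (IsGaussian.hasGaussianLaw_id (μ := μ)).map
        (R.prod (ContinuousLinearMap.pi fun _ : Unit => T))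
    have := hlaw.indepFun_of_covariance_eval (X := fun i v => R v i) (Y := fun _ v => T v)
      fun i _ => by
        have : (fun v => R v i) = fun v => v i - h i * T v := by
          ext v; rw [hRv]; simp [mul_comm]
        rw [this, covariance_fun_sub_left (hcoord i) (hTm.const_mul _) hTm,
          covariance_const_mul_left, covariance_self (by fun_prop), hvar, hh]
        field_simp
        simp
    exact this.comp measurable_id (measurable_pi_apply ())
  have hlawT : μ.map T = gaussianReal (μ[T]) q.toNNReal := by
    rw [IsGaussian.map_eq_gaussianReal T, hvar]
  have hprod : μ.map (fun v => (R v, T v)) = (μ.map R).prod (μ.map T) :=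
    (indepFun_iff_map_prod_eq_prod_map_map (by fun_prop) (by fun_prop)).1 hind
  have hRp : IsProbabilityMeasure (μ.map R) := Measure.isProbabilityMeasure_map (by fun_prop)
  have hTp : IsProbabilityMeasure (μ.map T) := Measure.isProbabilityMeasure_map (by fun_prop)
  have hbdd : ∀ {α : Type} [MeasurableSpace α] {ν : Measure α} [IsProbabilityMeasure ν]
      {f : α → Fin n → ℝ}, Measurable f → Integrable (fun x => F (f x)) ν := fun hf =>
    integrable_of_mem_Icc (hFc.measurable.comp hf).aestronglyMeasurable (fun x => h0 _)
      fun x => h1 _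
  have hshift : ∀ t : ℝ, ∫ v, F (R v + (T v - t) • h) ∂μ =
      ∫ r, ∫ z, F (r + (z - t) • h) ∂(μ.map T) ∂(μ.map R) := by
    intro t
    rw [← integral_prod (fun p : (Fin n → ℝ) × ℝ => F (p.1 + (p.2 - t) • h))
      (hbdd (f := fun p : (Fin n → ℝ) × ℝ => p.1 + (p.2 - t) • h) (by fun_prop)), ← hprod,
      integral_map (by fun_prop) (Continuous.aestronglyMeasurable (by fun_prop))]
  -- Lowering `T` by `ε` lowers each coordinate in `I` by at least `ε`; the other coordinates do not
  -- affect `F`.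
  have hle : ∫ v, F (R v + (T v - ε) • h) ∂μ ≤ ∫ v, F (v - fun _ => ε) ∂μ := by
    refine integral_mono (hbdd (by fun_prop)) (hbdd (by fun_prop)) fun v => ?_
    have := hF (x := R v + (T v - ε) • h) (y := v - fun _ => ε) (s := 0) le_rfl fun i hi => by
      have h2 := congrFun (hdec v) i
      simp only [Pi.add_apply, Pi.smul_apply, smul_eq_mul, Pi.sub_apply] at h2 ⊢
      nlinarith [hh1 i hi]
    simpa using this
  have heq : ∫ v, F v ∂μ = ∫ r, ∫ z, F (r + z • h) ∂(μ.map T) ∂(μ.map R) := by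
    have := hshift 0
    simpa only [sub_zero, hdec] using this
  have hIi : ∀ t : ℝ, Integrable (fun r => ∫ z, F (r + (z - t) • h) ∂(μ.map T)) (μ.map R) :=
    fun t => (hbdd (ν := (μ.map R).prod (μ.map T))
      (f := fun p : (Fin n → ℝ) × ℝ => p.1 + (p.2 - t) • h) (by fun_prop)).integral_prod_left
  have hIi0 : Integrable (fun r => ∫ z, F (r + z • h) ∂(μ.map T)) (μ.map R) := by
    simpa only [sub_zero] using hIi 0
  calc ∫ v, F v ∂μ - ∫ v, F (v - fun _ => ε) ∂μ
      ≤ ∫ v, F v ∂μ - ∫ v, F (R v + (T v - ε) • h) ∂μ := by linarith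
    _ = ∫ r, ((∫ z, F (r + z • h) ∂(μ.map T)) - ∫ z, F (r + (z - ε) • h) ∂(μ.map T))
          ∂(μ.map R) := by rw [heq, hshift ε, integral_sub hIi0 (hIi ε)]
    _ ≤ ∫ _, ε / √q ∂(μ.map R) := by
        refine integral_mono (hIi0.sub (hIi ε)) (integrable_const _) fun r => ?_
        simp only [hlawT]
        have := integral_gaussianReal_sub_shift_le (m := μ[T]) (ε := ε) (v := q.toNNReal)
          (by simpa using hq0) hε (φ := fun z => F (r + z • h))
          (Continuous.measurable (by fun_prop)) (fun z => h0 _) (fun z => h1 _)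
        rwa [Real.coe_toNNReal _ hq0.le] at this
    _ = ε / √q := by simp

/-! ### From functions to events -/

/-- The translation erasing the coordinates off `I` may be chosen for each `ω` separately. This
makes the event a measurable function of the block when `A` is measurable. -/
lemma IsSupportedOn.mem_iff_indicator_mem {Ω : Type*} {n : ℕ} {X : Ω → (Fin n → ℝ)}
    {I : Finset (Fin n)} {A : Set (Fin n → ℝ)}
    (h : IsSupportedOn X I A) (ω : Ω) :
    X ω ∈ A ↔ (fun i => if i ∈ I then X ω i else 0) ∈ A := by
  have hv := Set.ext_iff.1 (h (fun i => if i ∈ I then 0 else -X ω i) fun i hi => by simp [hi]) ω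
  have e : (X ω + fun i => if i ∈ I then 0 else -X ω i) = fun i => if i ∈ I then X ω i else 0 := by
    ext i
    by_cases hi : i ∈ I <;> simp [hi]
  exact hv.trans (e ▸ Iff.rfl)

section Events

variable {Ω : Type*} [MeasurableSpace Ω] {n : ℕ} {P : Measure Ω}
  {X : Ω → (Fin n → ℝ)}

/-- Events supported on uncorrelated blocks of coordinates are independent. -/
lemma measureReal_inter_eq_mul_of_covKernel_eq_zero (hX : HasGaussianLaw X P)
    {I J : Finset (Fin n)} {A B : Set (Fin n → ℝ)} (hA : MeasurableSet A) (hB : MeasurableSet B)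
    (hAI : IsSupportedOn X I A) (hBJ : IsSupportedOn X J B)
    (hK : ∀ i ∈ I, ∀ j ∈ J, covKernel P X i j = 0) :
    P.real {ω | X ω ∈ A ∩ B} = P.real {ω | X ω ∈ A} * P.real {ω | X ω ∈ B} := by
  have hlaw : HasGaussianLaw (fun ω => (fun i : I => X ω i, fun j : J => X ω j)) P :=
    hX.map ((ContinuousLinearMap.pi fun i : I => ContinuousLinearMap.proj (i : Fin n)).prod
      (ContinuousLinearMap.pi fun j : J => ContinuousLinearMap.proj (j : Fin n)))
  have hind := hlaw.indepFun_of_covariance_eval (X := fun (i : I) ω => X ω i)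
    (Y := fun (j : J) ω => X ω j) fun i j => hK i i.2 j j.2
  have hext : ∀ S : Finset (Fin n), Measurable
      fun (y : S → ℝ) (i : Fin n) => if h : i ∈ S then y ⟨i, h⟩ else 0 := fun S =>
    measurable_pi_lambda _ fun i => by
      by_cases h : i ∈ S <;> simp only [h, dite_true, dite_false] <;> fun_prop
  have hmem : ∀ {S : Finset (Fin n)} {C : Set (Fin n → ℝ)}, IsSupportedOn X S C →
      {ω | X ω ∈ C} = (fun ω (i : S) => X ω i) ⁻¹'
        ((fun (y : S → ℝ) (i : Fin n) => if h : i ∈ S then y ⟨i, h⟩ else 0) ⁻¹' C) := by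
    intro S C hS
    ext ω
    simpa using hS.mem_iff_indicator_mem ω
  have hinter : {ω | X ω ∈ A ∩ B} = {ω | X ω ∈ A} ∩ {ω | X ω ∈ B} := rfl
  rw [hinter, hmem hAI, hmem hBJ, measureReal_def, hind.measure_inter_preimage_eq_mul _ _
    (hext I hA) (hext J hB), ENNReal.toReal_mul, measureReal_def, measureReal_def]

lemma covKernel_eq_covariance_map (hX : AEMeasurable X P) (i j : Fin n) :
    covKernel P X i j = cov[fun v => v i, fun v => v j; P.map X] := by
  rw [covariance_map_fun (measurable_pi_apply i).aestronglyMeasurable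
    (measurable_pi_apply j).aestronglyMeasurable hX]
  rfl

/-- The indicator of an increasing event is close in `L¹` to a Lipschitz function. -/
lemma exists_shiftLipschitz_integral_le (hX : HasGaussianLaw X P)
    {I : Finset (Fin n)} {A : Set (Fin n → ℝ)} (hA : MeasurableSet A) (hinc : IsIncreasing X A)
    (hsup : IsSupportedOn X I A) (hne : ∃ ω, X ω ∈ A) {ε q : ℝ} (hε : 0 < ε) (w : I → ℝ)
    (hq : ∑ i : I, ∑ j : I, w i * covKernel P X i j * w j = q) (hq0 : 0 < q)
    (hpot : ∀ i : I, q ≤ ∑ j : I, covKernel P X i j * w j) :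
    ∃ F : (Fin n → ℝ) → ℝ, ShiftLipschitz I ε⁻¹ F ∧ (∀ x, 0 ≤ F x) ∧ (∀ x, F x ≤ 1) ∧
      ∫ v, |A.indicator (fun _ => 1) v - F v| ∂(P.map X) ≤ ε / √q := by
  have := hX.isGaussian_map
  obtain ⟨F, hF, h0, h1, hFA, hFA'⟩ := exists_shiftLipschitz_majorant hinc hsup hε hne
  refine ⟨F, hF, h0, h1, ?_⟩
  have hFc := hF.lipschitzWith.continuous
  have hFs : Continuous fun v => F (v - fun _ => ε) := by fun_prop
  have hAi : Integrable (A.indicator fun _ => (1 : ℝ)) (P.map X) :=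
    (integrable_const 1).indicator hA
  have hFi : Integrable F (P.map X) := integrable_of_mem_Icc hFc.aestronglyMeasurable h0 h1
  have hFsi : Integrable (fun v => F (v - fun _ => ε)) (P.map X) :=
    integrable_of_mem_Icc hFs.aestronglyMeasurable (fun v => h0 _) fun v => h1 _
  have hAm : Measurable (A.indicator fun _ => (1 : ℝ)) := measurable_const.indicator hA
  -- The indicator lies between `F (v - ε)` and `F v`, known only at values of `X`, hence almost
  -- everywhere for the law. The L¹ error is thus at most the cost of the shift.
  have hae1 : ∀ᵐ v ∂(P.map X), A.indicator (fun _ => (1 : ℝ)) v ≤ F v := by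
    rw [ae_map_iff hX.aemeasurable (measurableSet_le hAm hFc.measurable)]
    refine .of_forall fun ω => ?_
    by_cases h : X ω ∈ A
    · simp [h, hFA ω h]
    · simp [h, h0]
  have hae2 : ∀ᵐ v ∂(P.map X), F (v - fun _ => ε) ≤ A.indicator (fun _ => (1 : ℝ)) v := by
    rw [ae_map_iff hX.aemeasurable (measurableSet_le hFs.measurable hAm)]
    refine .of_forall fun ω => ?_
    by_cases h : X ω ∈ A
    · simp [h, h1]
    · simp [h, hFA' ω h]
  simp only [covKernel_eq_covariance_map hX.aemeasurable] at hq hpot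
  refine le_trans ?_ (hF.integral_sub_shift_le h0 h1 hε.le w hq hq0 hpot)
  rw [← integral_sub hFi hFsi]
  refine integral_mono_ae (hAi.sub hFi).abs (hFi.sub hFsi) ?_
  filter_upwards [hae1, hae2] with v hv1 hv2
  rw [abs_sub_comm, abs_of_nonneg (by linarith)]
  linarith

lemma abs_measureReal_inter_sub_le (hX : HasGaussianLaw X P) {I J : Finset (Fin n)}
    {A B : Set (Fin n → ℝ)} (hA : MeasurableSet A) (hB : MeasurableSet B)
    (hAinc : IsIncreasing X A) (hBinc : IsIncreasing X B)
    (hAI : IsSupportedOn X I A) (hBJ : IsSupportedOn X J B) {κ : ℝ} (hκ : 0 ≤ κ)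
    (hK : ∀ i ∈ I, ∀ j ∈ J, |covKernel P X i j| ≤ κ) (w : I → ℝ) (u : J → ℝ) {q r : ℝ}
    (hq : ∑ i : I, ∑ j : I, w i * covKernel P X i j * w j = q) (hq0 : 0 < q)
    (hpot : ∀ i : I, q ≤ ∑ j : I, covKernel P X i j * w j)
    (hr : ∑ i : J, ∑ j : J, u i * covKernel P X i j * u j = r) (hr0 : 0 < r)
    (hpot' : ∀ i : J, r ≤ ∑ j : J, covKernel P X i j * u j) {ε δ : ℝ} (hε : 0 < ε) (hδ : 0 < δ) :
    |P.real {ω | X ω ∈ A ∩ B} - P.real {ω | X ω ∈ A} * P.real {ω | X ω ∈ B}| ≤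
      κ * (ε⁻¹ * δ⁻¹) + 2 * (ε / √q + δ / √r) := by
  -- The majorant exists only if `X` meets the event; otherwise the left side is zero.
  by_cases hneA : ∃ ω, X ω ∈ A
  swap
  · have hA0 : ∀ ω, X ω ∉ A := fun ω h => hneA ⟨ω, h⟩
    simp only [Set.mem_inter_iff, hA0, false_and, Set.ofPred_false, measureReal_empty, zero_mul,
      sub_zero, abs_zero]
    positivity
  by_cases hneB : ∃ ω, X ω ∈ B
  swap
  · have hB0 : ∀ ω, X ω ∉ B := fun ω h => hneB ⟨ω, h⟩
    simp only [Set.mem_inter_iff, hB0, and_false, Set.ofPred_false, measureReal_empty, mul_zero,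
      sub_zero, abs_zero]
    positivity
  have := hX.isGaussian_map
  obtain ⟨F, hF, hF0, hF1, hFd⟩ :=
    exists_shiftLipschitz_integral_le hX hA hAinc hAI hneA hε w hq hq0 hpot
  obtain ⟨G, hG, hG0, hG1, hGd⟩ :=
    exists_shiftLipschitz_integral_le hX hB hBinc hBJ hneB hδ u hr hr0 hpot'
  simp only [covKernel_eq_covariance_map hX.aemeasurable] at hK
  have hFG := hF.abs_covariance_le (μ := P.map X) (by positivity) (by positivity) hG hF0 hF1
    hG0 hG1 hκ hK
  have hind0 : ∀ (C : Set (Fin n → ℝ)) (v : Fin n → ℝ), 0 ≤ C.indicator (fun _ => (1 : ℝ)) v :=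
    fun C v => Set.indicator_nonneg (fun _ _ => zero_le_one) v
  have hind1 : ∀ (C : Set (Fin n → ℝ)) (v : Fin n → ℝ), C.indicator (fun _ => (1 : ℝ)) v ≤ 1 :=
    fun C v => Set.indicator_le_self' (fun _ _ => zero_le_one) v
  have hdiff := abs_covariance_sub_le (μ := P.map X) (measurable_const.indicator hA)
    (measurable_const.indicator hB) hF.lipschitzWith.continuous.measurable
    hG.lipschitzWith.continuous.measurable (hind0 A) (hind1 A) (hind0 B) (hind1 B)
    hF0 hF1 hG0 hG1
  have hmem : ∀ {C : Set (Fin n → ℝ)}, MeasurableSet C →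
      MemLp (C.indicator fun _ => (1 : ℝ)) 2 (P.map X) := fun hC => (memLp_const 1).indicator hC
  have hreal : ∀ {C : Set (Fin n → ℝ)}, MeasurableSet C →
      (P.map X).real C = P.real {ω | X ω ∈ C} := fun hC =>
    map_measureReal_apply_of_aemeasurable hX.aemeasurable hC
  have hcov : cov[A.indicator fun _ => (1 : ℝ), B.indicator fun _ => (1 : ℝ); P.map X] =
      P.real {ω | X ω ∈ A ∩ B} - P.real {ω | X ω ∈ A} * P.real {ω | X ω ∈ B} := by
    have hmul : (A.indicator fun _ => (1 : ℝ)) * (B.indicator fun _ => (1 : ℝ)) =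
        (A ∩ B).indicator fun _ => (1 : ℝ) := by
      exact Set.inter_indicator_one.symm
    rw [covariance_eq_sub (hmem hA) (hmem hB), hmul, integral_indicator_const _ hA,
      integral_indicator_const _ hB, integral_indicator_const _ (hA.inter hB), hreal hA, hreal hB,
      hreal (hA.inter hB)]
    simp
  rw [← hcov]
  have h3 := abs_sub_abs_le_abs_sub (cov[A.indicator fun _ => (1 : ℝ),
    B.indicator fun _ => (1 : ℝ); P.map X]) (cov[F, G; P.map X])
  linarith

end Events

lemma abs_le_supNormBlock {n : ℕ} (K : Fin n → Fin n → ℝ) {I J : Finset (Fin n)} {i j : Fin n}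
    (hi : i ∈ I) (hj : j ∈ J) : |K i j| ≤ supNormBlock K I J := by
  have : ‖K i j‖₊ ≤ supNormBlock K I J :=
    Finset.le_sup (f := fun p : Fin n × Fin n => ‖K p.1 p.2‖₊)
      (Finset.mk_mem_product hi hj)
  exact_mod_cast this

end GaussianDecoupling

/-! ### Degenerate cases and choice of scales -/

theorem corollaryc :
    ∃ c : ℝ≥0, 0 < c ∧
      ∀ (n : ℕ) (Ω : Type*) (_ : MeasurableSpace Ω) (P : Measure Ω) (_ : IsProbabilityMeasure P)
        (X : Ω → (Fin n → ℝ)) (_ : HasGaussianLaw X P)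
        (I₁ I₂ : Finset (Fin n)) (A₁ A₂ : Set (Fin n → ℝ))
        (_ : MeasurableSet A₁) (_ : MeasurableSet A₂)
        (_ : GaussianDecoupling.IsIncreasing X A₁) (_ : GaussianDecoupling.IsIncreasing X A₂)
        (_ : GaussianDecoupling.IsSupportedOn X I₁ A₁)
        (_ : GaussianDecoupling.IsSupportedOn X I₂ A₂),
        ENNReal.ofReal |P.real {ω | X ω ∈ A₁ ∩ A₂} -
            P.real {ω | X ω ∈ A₁} * P.real {ω | X ω ∈ A₂}| ≤
          (c : ℝ≥0∞) *
            ((GaussianDecoupling.capacity (GaussianDecoupling.covKernel P X) I₁ *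
                GaussianDecoupling.capacity (GaussianDecoupling.covKernel P X) I₂) ^ (1 / 2 : ℝ) *
              (GaussianDecoupling.supNormBlock
                (GaussianDecoupling.covKernel P X) I₁ I₂ : ℝ≥0∞)) ^ (1 / 3 : ℝ) := by
  refine ⟨5, by norm_num, ?_⟩
  intro n Ω _ P _ X hX I₁ I₂ A₁ A₂ hA₁ hA₂ hinc₁ hinc₂ hsup₁ hsup₂
  set K := GaussianDecoupling.covKernel P X with hK
  set κ := GaussianDecoupling.supNormBlock K I₁ I₂ with hκ
  have hKκ : ∀ i ∈ I₁, ∀ j ∈ I₂, |K i j| ≤ κ := fun i hi j hj =>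
    GaussianDecoupling.abs_le_supNormBlock K hi hj
  -- Here the right side is 0 even for infinite capacities, so exact independence is needed. Empty
  -- blocks fall under this case.
  rcases eq_or_ne κ 0 with h0 | hκ0
  · rw [GaussianDecoupling.measureReal_inter_eq_mul_of_covKernel_eq_zero hX hA₁ hA₂ hsup₁ hsup₂
      fun i hi j hj => abs_nonpos_iff.1 (by simpa [h0] using hKκ i hi j hj)]
    simp
  have hκpos : (0 : ℝ) < κ := by positivity
  have hI₁ : I₁.Nonempty := by
    by_contra h
    exact hκ0 (by simp [hκ, GaussianDecoupling.supNormBlock, Finset.not_nonempty_iff_eq_empty.1 h])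
  have hI₂ : I₂.Nonempty := by
    by_contra h
    exact hκ0 (by simp [hκ, GaussianDecoupling.supNormBlock, Finset.not_nonempty_iff_eq_empty.1 h])
  have hsymm : ∀ i j, K i j = K j i := fun i j => covariance_comm _ _
  obtain ⟨w, -, hcap₁, hpot₁⟩ := GaussianDecoupling.exists_equilibrium hsymm hI₁
  obtain ⟨u, -, hcap₂, hpot₂⟩ := GaussianDecoupling.exists_equilibrium hsymm hI₂
  set q := ∑ i : I₁, ∑ j : I₁, w i * K i j * w j with hq
  set r := ∑ i : I₂, ∑ j : I₂, u i * K i j * u j with hr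
  rw [hcap₁, hcap₂]
  -- A block of zero energy makes the bound trivial: the other capacity is nonzero, as the inverse
  -- of a finite energy, and `κ ≠ 0`.
  have htop : ∀ x y : ℝ≥0∞, x = ⊤ → y ≠ 0 →
      ((5 : ℝ≥0) : ℝ≥0∞) * ((x * y) ^ (1 / 2 : ℝ) * κ) ^ (1 / 3 : ℝ) = ⊤ := by
    intro x y hx hy
    rw [hx, ENNReal.top_mul hy, ENNReal.top_rpow_of_pos (by norm_num),
      ENNReal.top_mul (by exact_mod_cast hκ0), ENNReal.top_rpow_of_pos (by norm_num),
      ENNReal.mul_top (by norm_num)]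
  rcases le_or_gt q 0 with hq0 | hq0
  · rw [htop _ _ (by simp [hq0]) (by simp)]
    exact le_top
  rcases le_or_gt r 0 with hr0 | hr0
  · rw [mul_comm (ENNReal.ofReal q)⁻¹, htop _ _ (by simp [hr0]) (by simp)]
    exact le_top
  set s := (q⁻¹ * r⁻¹) ^ (1 / 2 : ℝ) * (κ : ℝ) with hs
  have hs0 : 0 < s := by positivity
  set t := s ^ (1 / 3 : ℝ) with ht
  have ht0 : 0 < t := by positivity
  have ht3 : t ^ 3 = s := by
    rw [ht, ← Real.rpow_natCast, ← Real.rpow_mul hs0.le]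
    norm_num
  have hRHS : ((5 : ℝ≥0) : ℝ≥0∞) * (((ENNReal.ofReal q)⁻¹ * (ENNReal.ofReal r)⁻¹) ^ (1 / 2 : ℝ) *
      κ) ^ (1 / 3 : ℝ) = ENNReal.ofReal (5 * t) := by
    rw [← ENNReal.ofReal_inv_of_pos hq0, ← ENNReal.ofReal_inv_of_pos hr0,
      ← ENNReal.ofReal_mul (by positivity), ENNReal.ofReal_rpow_of_pos (by positivity),
      ← ENNReal.ofReal_coe_nnreal (p := κ), ← ENNReal.ofReal_mul (by positivity),
      ENNReal.ofReal_rpow_of_pos hs0, ENNReal.ofReal_mul (by norm_num), ← ht]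
    simp
  rw [hRHS]
  refine ENNReal.ofReal_le_ofReal ?_
  have hsq : 0 < √q := Real.sqrt_pos.2 hq0
  have hsr : 0 < √r := Real.sqrt_pos.2 hr0
  -- With `ε = t * √q` and `δ = t * √r`, each of `κ / (ε * δ)`, `ε / √q` and `δ / √r` equals `t`, so
  -- the bound is `t + 2 * (t + t) = 5 * t`.
  have hsκ : (κ : ℝ) = t ^ 3 * (√q * √r) := by
    rw [ht3, hs, ← Real.sqrt_eq_rpow, Real.sqrt_mul (by positivity), Real.sqrt_inv, Real.sqrt_inv]
    field_simp
  refine (GaussianDecoupling.abs_measureReal_inter_sub_le hX hA₁ hA₂ hinc₁ hinc₂ hsup₁ hsup₂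
    κ.2 hKκ w u hq.symm hq0 hpot₁ hr.symm hr0 hpot₂ (ε := t * √q) (δ := t * √r) (by positivity) (by positivity)).trans
    (le_of_eq ?_)
  change (κ : ℝ) * _ + _ = _
  rw [hsκ]
  field_simp
  ring
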